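/- Let $E$ be a countable state space and, for each parameter $\theta\in\mathbb R^k$, let $c^\theta(\sigma,\sigma')\ge 0$ ($\sigma,\sigma'\in E$) be the transition rates of a continuous-time Markov chain, with $c^\theta(\sigma,\sigma)=0$ and finite total rates $\lambda^\theta(\sigma)=\sum_{\sigma'\in E}c^\theta(\sigma,\sigma')<\infty$. The chain waits in a state $\sigma$ for an exponential time of intensity $\lambda^\theta(\sigma)$ (forever if $\lambda^\theta(\sigma)=0$) and then jumps to $\sigma'$ with probability $c^\theta(\sigma,\sigma')/\lambda^\theta(\sigma)$; if infinitely many jumps accumulate in finite time, it is sent to a cemetery state outside $E$. A probability measure $\mu$ on $E$ is called stationary if the chain started from $\mu$ has law $\mu$ at every time $t\ge 0$ (in particular, it then almost surely does not explode). Fix $\theta,\epsilon\in\mathbb R^k$ and assume that for all $\sigma,\sigma'\in E$, $c^\theta(\sigma,\sigma')=0$ if and only if $c^{\theta+\epsilon}(\sigma,\sigma')=0$. Let $\mu^\theta$ and $\mu^{\theta+\epsilon}$ be stationary probability measures of the chains with rates $c^\theta$ and $c^{\theta+\epsilon}$, let $T\ge 0$, and let $Q^\theta_{0,T}$ and $Q^{\theta+\epsilon}_{0,T}$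 be the laws on path space (with the $\sigma$-algebra generated by the coordinates) of the paths $(\sigma_t)_{0\le t\le T}$ of these chains started from $\mu^\theta$ and $\mu^{\theta+\epsilon}$ respectively. Write $\mathcal R(P\,|\,Q)=\int\log\frac{dP}{dQ}\,dP\in[0,\infty]$ for the relative entropy, with the value $\infty$ if $P\not\ll Q$. Then, as an identity in $[0,\infty]$, $$\mathcal R\big(Q^\theta_{0,T}\,\big|\,Q^{\theta+\epsilon}_{0,T}\big)=T\,\mathcal H+\mathcal R\big(\mu^\theta\,\big|\,\mu^{\theta+\epsilon}\big),$$ where the relative entropy rate $\mathcal H$ is $$\mathcal H=\mathbb E_{\mu^\theta}\Big[\sum_{\sigma'\in E}c^\theta(\sigma,\sigma')\log\frac{c^\theta(\sigma,\sigma')}{c^{\theta+\epsilon}(\sigma,\sigma')}-\big(\lambda^\theta(\sigma)-\lambda^{\theta+\epsilon}(\sigma)\big)\Big].$$ Here terms with $c^\theta(\sigma,\sigma')=c^{\theta+\epsilon}(\sigma,\sigma')=0$ are $0$, the sum and the expectation are taken in the extended sense (integral of the positive part minus integral of the negative part), and $0\cdot\infty=0$. -/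

import Mathlib

open MeasureTheory ProbabilityTheory InformationTheory
open scoped ENNReal NNReal

noncomputable section

/-- Transition rates `c(σ, σ')` of a continuous-time Markov chain on `E`: nonnegative, a jump always
leads to a new state (`c(σ, σ) = 0`), and the total rate out of each state is finite. -/
structure JumpRates (E : Type*) where
  rate : E → E → ℝ
  rate_nonneg : ∀ σ σ', 0 ≤ rate σ σ'
  rate_self : ∀ σ, rate σ σ = 0
  summable_rate : ∀ σ, Summable (rate σ)

namespace JumpRates

variable {E : Type*}

/-- The total rate `λ(σ) = ∑_{σ'} c(σ, σ')`. -/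
def total (c : JumpRates E) (σ : E) : ℝ := ∑' σ', c.rate σ σ'

lemma total_nonneg (c : JumpRates E) (σ : E) : 0 ≤ c.total σ :=
  tsum_nonneg (c.rate_nonneg σ)

open Classical in
/-- Law of the waiting time in `σ`: exponential with intensity `λ(σ)`, or `∞` if `λ(σ) = 0`
(absorbing state). -/
def holdingLaw (c : JumpRates E) (σ : E) : Measure ℝ≥0∞ :=
  if 0 < c.total σ then (expMeasure (c.total σ)).map ENNReal.ofReal else Measure.dirac ∞

instance (c : JumpRates E) (σ : E) : IsProbabilityMeasure (c.holdingLaw σ) := by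
  unfold holdingLaw
  split_ifs with h
  · have := isProbabilityMeasure_expMeasure h
    exact Measure.isProbabilityMeasure_map ENNReal.measurable_ofReal.aemeasurable
  · infer_instance

variable [MeasurableSpace E]

open Classical in
/-- Law of the state after the next jump from `σ`, that is `p(σ, σ') = c(σ, σ') / λ(σ)`. In an
absorbing state the embedded chain stays put. -/
def jumpLaw (c : JumpRates E) (σ : E) : Measure E :=
  if 0 < c.total σ then
    Measure.sum fun σ' => ENNReal.ofReal (c.rate σ σ' / c.total σ) • Measure.dirac σ'
  else Measure.dirac σ

instance (c : JumpRates E) (σ : E) : IsProbabilityMeasure (c.jumpLaw σ) := by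
  unfold jumpLaw
  split_ifs with h
  · constructor
    rw [Measure.sum_apply _ MeasurableSet.univ]
    simp only [Measure.smul_apply, measure_univ, smul_eq_mul, mul_one]
    rw [← ENNReal.ofReal_tsum_of_nonneg
      (fun σ' => div_nonneg (c.rate_nonneg σ σ') (c.total_nonneg σ))
      ((c.summable_rate σ).div_const _), tsum_div_const]
    change ENNReal.ofReal (c.total σ / c.total σ) = 1
    rw [div_self h.ne', ENNReal.ofReal_one]
  · infer_instance

variable [DiscreteMeasurableSpace E] [Countable E]

def holdingKernel (c : JumpRates E) : Kernel E ℝ≥0∞ := Kernel.ofFunOfCountable c.holdingLaw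

instance (c : JumpRates E) : IsMarkovKernel c.holdingKernel :=
  ⟨fun σ => inferInstanceAs (IsProbabilityMeasure (c.holdingLaw σ))⟩

def jumpKernel (c : JumpRates E) : Kernel E E := Kernel.ofFunOfCountable c.jumpLaw

instance (c : JumpRates E) : IsMarkovKernel c.jumpKernel :=
  ⟨fun σ => inferInstanceAs (IsProbabilityMeasure (c.jumpLaw σ))⟩

/-- Given the states `J₀, …, Jₙ` and their waiting times, the next state `J_{n+1}` has law
`p(Jₙ, ·)`, and its waiting time is then exponential with intensity `λ(J_{n+1})`. -/
def stepKernel (c : JumpRates E) (n : ℕ) : Kernel ((_ : Finset.Iic n) → E × ℝ≥0∞) (E × ℝ≥0∞) :=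
  (c.jumpKernel ⊗ₖ c.holdingKernel.prodMkLeft E).comap
    (fun x => (x ⟨n, Finset.mem_Iic.2 le_rfl⟩).1) (by fun_prop)

instance (c : JumpRates E) (n : ℕ) : IsMarkovKernel (c.stepKernel n) := by
  unfold stepKernel; infer_instance

/-- The joint law of the embedded chain and of the waiting times `(Jₙ, τₙ)_{n ≥ 0}` when `J₀` has
law `μ`. -/
def skeletonLaw (c : JumpRates E) (μ : Measure E) : Measure (ℕ → E × ℝ≥0∞) :=
  Kernel.trajMeasure (X := fun _ => E × ℝ≥0∞) (μ ⊗ₘ c.holdingKernel) c.stepKernel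

end JumpRates

/-- The time `τ₀ + ⋯ + τ_{n-1}` of the `n`-th jump. -/
def jumpTime {E : Type*} (ω : ℕ → E × ℝ≥0∞) (n : ℕ) : ℝ≥0∞ := ∑ i ∈ Finset.range n, (ω i).2

open Classical in
/-- The state at time `t` of the right-continuous step path with states `Jₙ` and waiting times `τₙ`;
the point `Sum.inr ()` is the cemetery, where the path is once infinitely many jumps have
accumulated. -/
def stateAt {E : Type*} (ω : ℕ → E × ℝ≥0∞) (t : ℝ≥0) : E ⊕ Unit :=
  if h : ∃ n, jumpTime ω n ≤ t ∧ (t : ℝ≥0∞) < jumpTime ω (n + 1) then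
    Sum.inl (ω (Nat.find h)).1
  else Sum.inr ()

lemma measurable_jumpTime {E : Type*} [MeasurableSpace E] (n : ℕ) :
    Measurable fun ω : ℕ → E × ℝ≥0∞ => jumpTime ω n := by
  unfold jumpTime; fun_prop

lemma measurable_stateAt {E : Type*} [MeasurableSpace E] (t : ℝ≥0) :
    Measurable fun ω : ℕ → E × ℝ≥0∞ => stateAt ω t := by
  classical
  have hA : ∀ n, MeasurableSet
      {ω : ℕ → E × ℝ≥0∞ | jumpTime ω n ≤ t ∧ (t : ℝ≥0∞) < jumpTime ω (n + 1)} := fun n =>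
    (measurableSet_le (measurable_jumpTime n) measurable_const).inter
      (measurableSet_lt measurable_const (measurable_jumpTime (n + 1)))
  refine Measurable.dite (s := {ω | ∃ n, jumpTime ω n ≤ t ∧ (t : ℝ≥0∞) < jumpTime ω (n + 1)})
    (f := fun ω => Sum.inl (ω.1 (Nat.find ω.2)).1) (g := fun _ => Sum.inr ())
    ?_ measurable_const ?_
  · have hN : Measurable fun ω : {ω : ℕ → E × ℝ≥0∞ |
        ∃ n, jumpTime ω n ≤ t ∧ (t : ℝ≥0∞) < jumpTime ω (n + 1)} => Nat.find ω.2 :=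
      measurable_find (fun ω => ω.2) fun n => (hA n).preimage measurable_subtype_coe
    have hJ : Measurable fun p : (ℕ → E × ℝ≥0∞) × ℕ => (p.1 p.2).1 :=
      measurable_from_prod_countable_left fun n => by fun_prop
    exact measurable_inl.comp (hJ.comp (measurable_subtype_coe.prodMk hN))
  · rw [show {ω : ℕ → E × ℝ≥0∞ | ∃ n, jumpTime ω n ≤ t ∧ (t : ℝ≥0∞) < jumpTime ω (n + 1)}
      = ⋃ n, {ω | jumpTime ω n ≤ t ∧ (t : ℝ≥0∞) < jumpTime ω (n + 1)} by ext; simp]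
    exact MeasurableSet.iUnion hA

namespace JumpRates

variable {E : Type*} [MeasurableSpace E] [DiscreteMeasurableSpace E] [Countable E]

/-- The path measure on `[0, T]` of the chain with rates `c` and initial law `μ`: the law of
`(σ_t)_{0 ≤ t ≤ T}` on path space, with the σ-algebra generated by the coordinates. -/
def pathLaw (c : JumpRates E) (μ : Measure E) (T : ℝ≥0) : Measure (Set.Iic T → E ⊕ Unit) :=
  (c.skeletonLaw μ).map fun ω t => stateAt ω t

/-- `μ` is a stationary law: the chain started from `μ` has law `μ` on `E` at all times (so that,
started from `μ`, it does not explode). -/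
def IsStationary (c : JumpRates E) (μ : Measure E) : Prop :=
  ∀ t : ℝ≥0, (c.skeletonLaw μ).map (fun ω => stateAt ω t) = μ.map Sum.inl

end JumpRates

/-- The integral of an extended-real function, as the integral of its positive part minus that of
its negative part. -/
def eintegral {α : Type*} [MeasurableSpace α] (μ : Measure α) (f : α → EReal) : EReal :=
  ((∫⁻ x, (f x).toENNReal ∂μ : ℝ≥0∞) : EReal) - ((∫⁻ x, (-f x).toENNReal ∂μ : ℝ≥0∞) : EReal)

/-- The relative entropy rate
`E_μ [∑_{σ'} c(σ, σ') log (c(σ, σ') / c'(σ, σ')) - (λ(σ) - λ'(σ))]`; the sum is the integral for the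
counting measure, and a term with `c(σ, σ') = c'(σ, σ') = 0` is `0`. -/
def relEntropyRate {E : Type*} [MeasurableSpace E] (c c' : JumpRates E) (μ : Measure E) : EReal :=
  eintegral μ fun σ =>
    eintegral Measure.count
        (fun σ' => ((c.rate σ σ' * Real.log (c.rate σ σ' / c'.rate σ σ') : ℝ) : EReal))
      - ((c.total σ - c'.total σ : ℝ) : EReal)

end

/-!
The relative entropy of the path on `[0, T]` is computed through the chain of pairs (state, entrance
time), run until the window `[0, T]` is used up (`truncChain`). All quantities are nonnegative, so
that the identity holds in `[0, ∞]` without integrability assumptions.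

*From paths to the truncated chain.* The path up to time `T` is a function of the truncated chain.
Conversely the truncated chain is determined, almost surely, by the path at countably many times
(`injOn_stateAt_observationTime`), hence by the Lusin–Souslin theorem it is a measurable function of
the path. By data processing both laws have the same relative entropy (`JumpRates.klDiv_pathLaw`).

*One step.* The truncated chain is Markov. From a state `x`, with remaining time `r`, its step for
`c` has an explicit density with respect to its step for `c'`, and the relative entropy of the step
is `h(x) E[τ ∧ r]`, where `h(x) = ∑_y c'(x, y) φ(c(x, y) / c'(x, y))` with `φ(a) = a log a + 1 - a`,
and `τ` is the waiting time in `x` (`JumpRates.lintegral_klFun_stepDensity`). The integral of `h` is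
the relative entropy rate, since `c' φ(c / c') = c log (c / c') - c + c'`
(`relEntropyRate_eq_lintegral`).

*Summation.* The chain rule gives the relative entropy of the first `n` steps as the relative
entropy of the initial laws plus the expected sum of the step entropies. A stationary chain does not
explode, so the window is used up after finitely many steps under both laws, and one can let `n`
tend to infinity (`JumpRates.klDiv_truncChain`). The sum of the terms `h(x) E[τ ∧ r]` is the
expectation of the integral of `h` along the path over `[0, T]`, which by stationarity is `T` times
the integral of `h` with respect to the initial law (`JumpRates.tsum_lintegral_meanOccupation`).
-/

/-! ### Relative entropy: densities, chain rule, restriction to exhausting events -/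

section RelativeEntropy

variable {𝓧 𝓨 : Type*} [MeasurableSpace 𝓧] [MeasurableSpace 𝓨]

lemma klDiv_withDensity {ν : Measure 𝓧} [IsFiniteMeasure ν] {f : 𝓧 → ℝ≥0∞} (hf : Measurable f)
    [IsFiniteMeasure (ν.withDensity f)] :
    klDiv (ν.withDensity f) ν = ∫⁻ x, ENNReal.ofReal (klFun (f x).toReal) ∂ν := by
  rw [klDiv_eq_lintegral_klFun_of_ac (withDensity_absolutelyContinuous ν f)]
  refine lintegral_congr_ae ?_
  filter_upwards [Measure.rnDeriv_withDensity ν hf] with x hx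
  rw [hx]

/-- Chain rule, with the conditional relative entropy in integral form when the kernels have a
jointly measurable density. -/
lemma klDiv_compProd_of_density {μ ν : Measure 𝓧} [IsProbabilityMeasure μ] [IsProbabilityMeasure ν]
    {κ η : Kernel 𝓧 𝓨} [IsMarkovKernel κ] [IsMarkovKernel η] {f : 𝓧 → 𝓨 → ℝ≥0∞}
    (hf : Measurable (Function.uncurry f)) (hκ : ∀ a, κ a = (η a).withDensity (f a)) :
    klDiv (μ ⊗ₘ κ) (ν ⊗ₘ η) =
      klDiv μ ν + ∫⁻ a, ∫⁻ b, ENNReal.ofReal (klFun (f a b).toReal) ∂η a ∂μ := by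
  have hκ' : κ = η.withDensity f := by
    ext1 a
    rw [hκ, Kernel.withDensity_apply _ hf]
  have : IsMarkovKernel (η.withDensity f) := hκ' ▸ inferInstance
  have hprod : μ ⊗ₘ κ = (μ ⊗ₘ η).withDensity fun p => f p.1 p.2 := by
    rw [hκ', Measure.compProd_withDensity hf]
  have : IsFiniteMeasure ((μ ⊗ₘ η).withDensity fun p => f p.1 p.2) := hprod ▸ inferInstance
  rw [klDiv_compProd_eq_add]
  congr 1
  rw [hprod, klDiv_withDensity (by exact hf), Measure.lintegral_compProd]
  exact (measurable_klFun.comp (ENNReal.measurable_toReal.comp hf)).ennreal_ofReal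

lemma klDiv_map_of_leftInverse {μ ν : Measure 𝓧} [IsProbabilityMeasure μ] [IsProbabilityMeasure ν]
    {g : 𝓧 → 𝓨} (hg : Measurable g) {k : 𝓨 → 𝓧} (hk : Measurable k)
    (hμ : ∀ᵐ x ∂μ, k (g x) = x) (hν : ∀ᵐ x ∂ν, k (g x) = x) :
    klDiv (μ.map g) (ν.map g) = klDiv μ ν := by
  refine le_antisymm (klDiv_map_le μ ν hg) ?_
  have := Measure.isProbabilityMeasure_map (μ := μ) hg.aemeasurable
  have := Measure.isProbabilityMeasure_map (μ := ν) hg.aemeasurable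
  have key : ∀ ρ : Measure 𝓧, (∀ᵐ x ∂ρ, k (g x) = x) → (ρ.map g).map k = ρ := fun ρ h => by
    rw [Measure.map_map hk hg, Measure.map_congr (f := k ∘ g) (g := id) h, Measure.map_id]
  calc klDiv μ ν = klDiv ((μ.map g).map k) ((ν.map g).map k) := by rw [key μ hμ, key ν hν]
    _ ≤ klDiv (μ.map g) (ν.map g) := klDiv_map_le _ _ hk

/-- An observable that is injective on a set of full measure loses no relative entropy. By the
Lusin–Souslin theorem it has a measurable inverse on that set. -/
lemma klDiv_map_of_injOn [StandardBorelSpace 𝓧] [MeasurableSpace.CountablySeparated 𝓨]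
    {μ ν : Measure 𝓧} [IsProbabilityMeasure μ] [IsProbabilityMeasure ν]
    {g : 𝓧 → 𝓨} (hg : Measurable g) {G : Set 𝓧} (hG : MeasurableSet G) (hinj : Set.InjOn g G)
    (hμ : ∀ᵐ x ∂μ, x ∈ G) (hν : ∀ᵐ x ∂ν, x ∈ G) :
    klDiv (μ.map g) (ν.map g) = klDiv μ ν := by
  have := hG.standardBorel
  have he : MeasurableEmbedding (fun x : G => g x) :=
    (hg.comp measurable_subtype_coe).measurableEmbedding (Set.injOn_iff_injective.1 hinj)
  have : Nonempty 𝓧 := nonempty_of_isProbabilityMeasure μ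
  obtain ⟨k, hk, hkg⟩ := he.exists_measurable_extend (measurable_subtype_coe (p := (· ∈ G)))
    fun _ => this
  refine klDiv_map_of_leftInverse hg hk ?_ ?_
  · filter_upwards [hμ] with x hx using congrFun hkg ⟨x, hx⟩
  · filter_upwards [hν] with x hx using congrFun hkg ⟨x, hx⟩

/-- If `Y n = X` on events that exhaust the space under both laws and that are visible both from
`X` and from `Y n`, then the relative entropy of `X` is at most the supremum of those of `Y n`. -/
lemma klDiv_map_le_of_exhaustion {Ω : Type*} [MeasurableSpace Ω] {P Q : Measure Ω}
    [IsProbabilityMeasure P] [IsProbabilityMeasure Q] {X : Ω → 𝓧} (hX : Measurable X)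
    {Y : ℕ → Ω → 𝓧} (hY : ∀ n, Measurable (Y n)) {D : ℕ → Set 𝓧} (hD : ∀ n, MeasurableSet (D n))
    (hmono : Monotone D) (hXD : ∀ n ω, X ω ∈ D n → Y n ω = X ω)
    (hYD : ∀ n ω, Y n ω ∈ D n → Y n ω = X ω)
    (hP : ∀ᵐ ω ∂P, ∃ n, X ω ∈ D n) (hQ : ∀ᵐ ω ∂Q, ∃ n, X ω ∈ D n) :
    klDiv (P.map X) (Q.map X) ≤ ⨆ n, klDiv (P.map (Y n)) (Q.map (Y n)) := by
  have hres : ∀ (ρ : Measure Ω) n, (ρ.map X).restrict (D n) = (ρ.map (Y n)).restrict (D n) := by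
    intro ρ n
    ext s hs
    rw [Measure.restrict_apply hs, Measure.restrict_apply hs,
      Measure.map_apply hX (hs.inter (hD n)), Measure.map_apply (hY n) (hs.inter (hD n))]
    congr 1
    ext ω
    constructor
    · rintro ⟨h1, h2⟩
      rw [Set.mem_preimage, hXD n ω h2]
      exact ⟨h1, h2⟩
    · rintro ⟨h1, h2⟩
      rw [Set.mem_preimage, ← hYD n ω h2]
      exact ⟨h1, h2⟩
  have hU : ∀ ρ : Measure Ω, (∀ᵐ ω ∂ρ, ∃ n, X ω ∈ D n) →
      (ρ.map X).restrict (⋃ n, D n) = ρ.map X := by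
    intro ρ hρ
    refine Measure.restrict_eq_self_of_ae_mem ?_
    refine (ae_map_iff hX.aemeasurable (p := (· ∈ ⋃ n, D n)) (MeasurableSet.iUnion hD)).2 ?_
    simpa using hρ
  by_cases hC : ⨆ n, klDiv (P.map (Y n)) (Q.map (Y n)) = ∞
  · rw [hC]; exact le_top
  have hprob : ∀ (ρ : Measure Ω) [IsProbabilityMeasure ρ] n, IsProbabilityMeasure (ρ.map (Y n)) :=
    fun ρ _ n => Measure.isProbabilityMeasure_map (hY n).aemeasurable
  have := Measure.isProbabilityMeasure_map (μ := P) hX.aemeasurable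
  have := Measure.isProbabilityMeasure_map (μ := Q) hX.aemeasurable
  have hacn : ∀ n, P.map (Y n) ≪ Q.map (Y n) := fun n => by
    by_contra h
    refine hC (top_le_iff.1 ?_)
    rw [← klDiv_of_not_ac h]
    exact le_iSup (fun n => klDiv (P.map (Y n)) (Q.map (Y n))) n
  have hac : P.map X ≪ Q.map X := by
    rw [← hU P hP]
    refine Measure.AbsolutelyContinuous.mk fun s hs h => ?_
    rw [Measure.restrict_apply hs, Set.inter_iUnion, measure_iUnion_null_iff]
    intro n
    rw [← Measure.restrict_apply hs, hres]
    refine ((hacn n).restrict (D n)) ?_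
    rw [← hres, Measure.restrict_apply hs]
    exact measure_mono_null Set.inter_subset_left h
  rw [klDiv_eq_lintegral_klFun_of_ac hac, ← hU Q hQ,
    setLIntegral_iUnion_of_directed _ hmono.directed_le]
  refine iSup_mono fun n => ?_
  rw [klDiv_eq_lintegral_klFun_of_ac (hacn n)]
  refine le_trans (le_of_eq ?_) (setLIntegral_le_lintegral (D n) _)
  have hden : (P.map X).rnDeriv (Q.map X) =ᵐ[(Q.map (Y n)).restrict (D n)]
      (P.map (Y n)).rnDeriv (Q.map (Y n)) := by
    refine (withDensity_eq_iff_of_sigmaFinite ?_ ?_).1 ?_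
    · fun_prop
    · fun_prop
    rw [← hres, ← restrict_withDensity (hD n), Measure.withDensity_rnDeriv_eq _ _ hac, hres, hres,
      ← restrict_withDensity (hD n), Measure.withDensity_rnDeriv_eq _ _ (hacn n)]
  rw [hU Q hQ, hres]
  refine lintegral_congr_ae ?_
  filter_upwards [hden] with x hx
  rw [hx]

end RelativeEntropy

/-! ### One step of the chain truncated at time `T` -/

/-- One step of the truncated chain: from the state `x` entered at time `s`, with waiting time `τ`
and next state `y`, the next pair is `(y, s + τ)` if this jump happens by time `T`, and `(x, ∞)`
otherwise. A pair with time `∞` is never left, so `∞` marks that the window `[0, T]` is used up. -/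
noncomputable def truncStep {E : Type*} (T : ℝ≥0) (z : E × ℝ≥0∞) (q : ℝ≥0∞ × E) : E × ℝ≥0∞ :=
  open Classical in if z.2 + q.1 ≤ T then (q.2, z.2 + q.1) else (z.1, ∞)

lemma truncStep_of_le {E : Type*} {T : ℝ≥0} {z : E × ℝ≥0∞} {q : ℝ≥0∞ × E} (h : z.2 + q.1 ≤ T) :
    truncStep T z q = (q.2, z.2 + q.1) := if_pos h

lemma truncStep_of_lt {E : Type*} {T : ℝ≥0} {z : E × ℝ≥0∞} {q : ℝ≥0∞ × E} (h : T < z.2 + q.1) :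
    truncStep T z q = (z.1, ∞) := if_neg h.not_ge

@[fun_prop]
lemma measurable_truncStep {E : Type*} [MeasurableSpace E] (T : ℝ≥0) :
    Measurable fun p : (E × ℝ≥0∞) × (ℝ≥0∞ × E) => truncStep T p.1 p.2 := by
  classical
  unfold truncStep
  exact Measurable.ite (measurableSet_le (by fun_prop) measurable_const) (by fun_prop)
    (by fun_prop)

/-- The part of the window `[0, T]` that is left at time `s`; it is `0` for `s = ∞`. -/
noncomputable def timeLeft (T : ℝ≥0) (s : ℝ≥0∞) : ℝ := (T - s : ℝ≥0∞).toReal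

lemma timeLeft_nonneg (T : ℝ≥0) (s : ℝ≥0∞) : 0 ≤ timeLeft T s := ENNReal.toReal_nonneg

@[fun_prop]
lemma measurable_timeLeft (T : ℝ≥0) : Measurable (timeLeft T) := by
  unfold timeLeft; fun_prop

lemma timeLeft_of_lt {T : ℝ≥0} {s : ℝ≥0∞} (h : T < s) : timeLeft T s = 0 := by
  simp [timeLeft, tsub_eq_zero_of_le h.le]

lemma add_ofReal_le_iff {T : ℝ≥0} {s : ℝ≥0∞} (h : s ≤ T) {u : ℝ} :
    s + ENNReal.ofReal u ≤ T ↔ u ≤ timeLeft T s := by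
  rw [timeLeft, ← ENNReal.ofReal_le_iff_le_toReal (by simp)]
  exact (ENNReal.cancel_of_ne (ne_top_of_le_ne_top ENNReal.coe_ne_top h)).le_tsub_iff_left h |>.symm

lemma timeLeft_eq_sub {T : ℝ≥0} {s : ℝ≥0∞} (h : s ≤ T) : timeLeft T s = T - s.toReal := by
  rw [timeLeft, ENNReal.toReal_sub_of_le h ENNReal.coe_ne_top, ENNReal.coe_toReal]

lemma ne_top_of_mem_Ioc_timeLeft {T : ℝ≥0} {s : ℝ≥0∞} {u : ℝ}
    (hu : u ∈ Set.Ioc 0 (timeLeft T s)) : s ≠ ∞ := by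
  rintro rfl
  rw [timeLeft_of_lt ENNReal.coe_lt_top] at hu
  exact absurd hu.1 (not_lt.2 hu.2)

lemma toReal_add_ofReal_sub {s : ℝ≥0∞} (hs : s ≠ ∞) {u : ℝ} (hu : 0 ≤ u) :
    (s + ENNReal.ofReal u - s).toReal = u := by
  rw [ENNReal.add_sub_cancel_left hs, ENNReal.toReal_ofReal hu]

namespace JumpRates

variable {E : Type*}

/-- Waiting times exceed `v` with probability `exp (-λ v)`, also in an absorbing state. -/
lemma holdingLaw_Ioi (c : JumpRates E) (x : E) {v : ℝ≥0∞} (hv : v ≠ ∞) :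
    c.holdingLaw x (Set.Ioi v) = ENNReal.ofReal (Real.exp (-(c.total x * v.toReal))) := by
  unfold holdingLaw
  split_ifs with h
  · have := isProbabilityMeasure_expMeasure h
    rw [Measure.map_apply ENNReal.measurable_ofReal measurableSet_Ioi]
    have hpre : ENNReal.ofReal ⁻¹' Set.Ioi v = (Set.Iic v.toReal)ᶜ := by
      ext u
      simp [ENNReal.lt_ofReal_iff_toReal_lt hv]
    rw [hpre, prob_compl_eq_one_sub measurableSet_Iic]
    have : expMeasure (c.total x) (Set.Iic v.toReal) =
        ENNReal.ofReal (1 - Real.exp (-(c.total x * v.toReal))) := by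
      rw [← ENNReal.ofReal_toReal (measure_ne_top _ (Set.Iic v.toReal))]
      have := cdf_expMeasure_eq h v.toReal
      rw [cdf_eq_real, if_pos ENNReal.toReal_nonneg] at this
      rw [← this]; rfl
    rw [this, ← ENNReal.ofReal_one, ← ENNReal.ofReal_sub]
    · congr 1; ring
    · simp only [sub_nonneg, Real.exp_le_one_iff, Left.neg_nonpos_iff]
      exact mul_nonneg h.le ENNReal.toReal_nonneg
  · have h0 : c.total x = 0 := le_antisymm (not_lt.1 h) (c.total_nonneg x)
    simp [h0, hv.lt_top]

lemma lintegral_holdingLaw (c : JumpRates E) (x : E) {f : ℝ≥0∞ → ℝ≥0∞} (hf : Measurable f) {r : ℝ}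
    (hr : 0 ≤ r) {a : ℝ≥0∞} (ha : ∀ τ, ENNReal.ofReal r < τ → f τ = a) :
    ∫⁻ τ, f τ ∂c.holdingLaw x = ENNReal.ofReal (Real.exp (-(c.total x * r))) * a +
      ∫⁻ u in Set.Ioc 0 r, ENNReal.ofReal (c.total x * Real.exp (-(c.total x * u))) *
        f (ENNReal.ofReal u) := by
  rw [← lintegral_add_compl f (measurableSet_Ioi (a := ENNReal.ofReal r))]
  congr 1
  · rw [setLIntegral_congr_fun measurableSet_Ioi (g := fun _ => a) (fun τ hτ => ha τ hτ)]
    rw [setLIntegral_const, holdingLaw_Ioi c x ENNReal.ofReal_ne_top, ENNReal.toReal_ofReal hr,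
      mul_comm]
  · unfold holdingLaw
    split_ifs with h
    · rw [setLIntegral_map measurableSet_Ioi.compl hf ENNReal.measurable_ofReal]
      have : expMeasure (c.total x) = volume.withDensity (exponentialPDF (c.total x)) := rfl
      have hm : Measurable (exponentialPDF (c.total x)) :=
        (measurable_exponentialPDFReal _).ennreal_ofReal
      have hpre : ENNReal.ofReal ⁻¹' (Set.Ioi (ENNReal.ofReal r))ᶜ = Set.Iic r := by
        ext u
        simp [ENNReal.ofReal_le_ofReal_iff hr]
      rw [hpre, this, setLIntegral_withDensity_eq_setLIntegral_mul _ hm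

        (g := fun u => f (ENNReal.ofReal u)) (hf.comp ENNReal.measurable_ofReal) measurableSet_Iic]
      have hsplit : Set.Iic r = Set.Iio 0 ∪ Set.Icc 0 r := by
        rw [Set.Iio_union_Icc_eq_Iic hr]
      rw [hsplit, lintegral_union measurableSet_Icc (by
        rw [Set.disjoint_left]; rintro u hu hu'; exact absurd hu'.1 (not_le.2 hu))]
      rw [setLIntegral_congr_fun measurableSet_Iio (g := fun _ => 0) (fun u hu => by
        simp [exponentialPDF_of_neg hu]), lintegral_zero, zero_add,
        setLIntegral_congr Ioc_ae_eq_Icc.symm]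
      refine setLIntegral_congr_fun measurableSet_Ioc fun u hu => ?_
      simp [exponentialPDF_of_nonneg hu.1.le]
    · have h0 : c.total x = 0 := le_antisymm (not_lt.1 h) (c.total_nonneg x)
      rw [setLIntegral_measure_zero _ _ (by simp)]
      simp [h0]

lemma ofReal_total (c : JumpRates E) (x : E) :
    ENNReal.ofReal (c.total x) = ∑' y, ENNReal.ofReal (c.rate x y) :=
  ENNReal.ofReal_tsum_of_nonneg (c.rate_nonneg x) (c.summable_rate x)

lemma rate_eq_zero_of_total (c : JumpRates E) {x : E} (h : ¬ 0 < c.total x) (y : E) :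
    c.rate x y = 0 := by
  refine le_antisymm ?_ (c.rate_nonneg x y)
  exact ((c.summable_rate x).le_tsum y fun z _ => c.rate_nonneg x z).trans (not_lt.1 h)

variable [MeasurableSpace E] [DiscreteMeasurableSpace E]

lemma total_mul_lintegral_jumpLaw (c : JumpRates E) (x : E) (f : E → ℝ≥0∞) :
    ENNReal.ofReal (c.total x) * ∫⁻ y, f y ∂c.jumpLaw x =
      ∑' y, ENNReal.ofReal (c.rate x y) * f y := by
  by_cases h : 0 < c.total x
  · rw [jumpLaw, if_pos h, lintegral_sum_measure, ← ENNReal.tsum_mul_left]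
    refine tsum_congr fun y => ?_
    rw [lintegral_smul_measure, lintegral_dirac, smul_eq_mul, ← mul_assoc,
      ← ENNReal.ofReal_mul h.le, mul_div_cancel₀ _ h.ne']
  · simp [le_antisymm (not_lt.1 h) (c.total_nonneg x), c.rate_eq_zero_of_total h]

variable [Countable E]

/-- The joint law of the waiting time in a state and of the next state. -/
noncomputable def clockKernel (c : JumpRates E) : Kernel E (ℝ≥0∞ × E) :=
  c.holdingKernel ×ₖ c.jumpKernel

instance (c : JumpRates E) : IsMarkovKernel c.clockKernel := by
  unfold clockKernel; infer_instance

/-- The transition kernel of the truncated chain. -/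
noncomputable def truncKernel (c : JumpRates E) (T : ℝ≥0) : Kernel (E × ℝ≥0∞) (E × ℝ≥0∞) :=
  (Kernel.id ×ₖ c.clockKernel.comap Prod.fst measurable_fst).map fun p => truncStep T p.1 p.2

instance (c : JumpRates E) (T : ℝ≥0) : IsMarkovKernel (c.truncKernel T) := by
  unfold truncKernel
  exact Kernel.IsMarkovKernel.map _ (measurable_truncStep T)

lemma lintegral_truncKernel_eq_clockKernel (c : JumpRates E) (T : ℝ≥0) (z : E × ℝ≥0∞)
    {f : E × ℝ≥0∞ → ℝ≥0∞} (hf : Measurable f) :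
    ∫⁻ w, f w ∂c.truncKernel T z = ∫⁻ q, f (truncStep T z q) ∂c.clockKernel z.1 := by
  have hm : Measurable fun p : (E × ℝ≥0∞) × (ℝ≥0∞ × E) => f (truncStep T p.1 p.2) := by fun_prop
  rw [truncKernel, Kernel.lintegral_map _ (measurable_truncStep T) _ hf,
    Kernel.lintegral_prod _ _ _ hm, Kernel.id_apply, lintegral_dirac' _ (by fun_prop),
    Kernel.comap_apply]

/-- Explicit form of the transition kernel: from `(x, s)`, with remaining time `r`, the chain runs
out of the window with probability `exp (-λ r)` and jumps to `y` after time `u ≤ r` with density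
`c(x, y) exp (-λ u)`. -/
lemma lintegral_truncKernel (c : JumpRates E) (T : ℝ≥0) (z : E × ℝ≥0∞)
    {f : E × ℝ≥0∞ → ℝ≥0∞} (hf : Measurable f) :
    ∫⁻ w, f w ∂c.truncKernel T z =
      ENNReal.ofReal (Real.exp (-(c.total z.1 * timeLeft T z.2))) * f (z.1, ∞) +
      ∫⁻ u in Set.Ioc 0 (timeLeft T z.2), ∑' y,
        ENNReal.ofReal (c.rate z.1 y * Real.exp (-(c.total z.1 * u))) *
          f (y, z.2 + ENNReal.ofReal u) := by
  rw [lintegral_truncKernel_eq_clockKernel c T z hf]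
  rcases lt_or_ge (T : ℝ≥0∞) z.2 with hT | hT
  · simp [timeLeft_of_lt hT, truncStep_of_lt (lt_of_lt_of_le hT le_self_add)]
  rw [clockKernel, Kernel.lintegral_prod _ _ _ (by fun_prop)]
  change ∫⁻ τ, ∫⁻ y, f (truncStep T z (τ, y)) ∂c.jumpLaw z.1 ∂c.holdingLaw z.1 = _
  rw [lintegral_holdingLaw c z.1 (Measurable.lintegral_prod_right (by fun_prop))
    (timeLeft_nonneg T z.2) (a := f (z.1, ∞))]
  · congr 1
    refine setLIntegral_congr_fun measurableSet_Ioc fun u hu => ?_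
    have hle := (add_ofReal_le_iff hT).2 hu.2
    simp only [truncStep_of_le (z := z) (q := (ENNReal.ofReal u, _)) hle]
    rw [ENNReal.ofReal_mul (c.total_nonneg _), mul_right_comm, total_mul_lintegral_jumpLaw,
      ← ENNReal.tsum_mul_right]
    refine tsum_congr fun y => ?_
    rw [ENNReal.ofReal_mul (c.rate_nonneg _ _), mul_right_comm]
  · intro τ hτ
    have : (T : ℝ≥0∞) < z.2 + τ := by
      by_contra! h
      have hτ' : τ ≠ ∞ := by rintro rfl; simp at h
      rw [← ENNReal.ofReal_toReal hτ', add_ofReal_le_iff hT] at h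
      exact absurd hτ (not_lt.2 ((ENNReal.le_ofReal_iff_toReal_le hτ' (timeLeft_nonneg _ _)).2 h))
    simp [truncStep_of_lt (z := z) (q := (τ, _)) this]

end JumpRates

/-! ### Relative entropy of one step -/

lemma ofReal_add_ofReal_neg {a b : ℝ} (ha : 0 ≤ a) (hab : 0 ≤ a + b) :
    ENNReal.ofReal (a + b) + ENNReal.ofReal (-b) = ENNReal.ofReal a + ENNReal.ofReal b := by
  rcases le_total 0 b with h | h
  · rw [ENNReal.ofReal_of_nonpos (neg_nonpos.2 h), add_zero, ENNReal.ofReal_add ha h]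
  · rw [ENNReal.ofReal_of_nonpos h, ← ENNReal.ofReal_add hab (neg_nonneg.2 h)]
    simp

lemma ofReal_integral_add_lintegral_neg {α : Type*} [MeasurableSpace α] {μ : Measure α} {b : α → ℝ}
    (hb : Integrable b μ) :
    ENNReal.ofReal (∫ x, b x ∂μ) + ∫⁻ x, ENNReal.ofReal (-b x) ∂μ =
      ENNReal.ofReal (-∫ x, b x ∂μ) + ∫⁻ x, ENNReal.ofReal (b x) ∂μ := by
  have h1 : ∫⁻ x, ENNReal.ofReal (b x) ∂μ ≠ ∞ := hb.lintegral_lt_top.ne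
  have h2 : ∫⁻ x, ENNReal.ofReal (-b x) ∂μ ≠ ∞ := hb.neg.lintegral_lt_top.ne
  have h := integral_eq_lintegral_pos_part_sub_lintegral_neg_part hb
  rw [h]
  generalize ∫⁻ x, ENNReal.ofReal (b x) ∂μ = p at *
  generalize ∫⁻ x, ENNReal.ofReal (-b x) ∂μ = n at *
  lift p to ℝ≥0 using h1
  lift n to ℝ≥0 using h2
  rw [← ENNReal.toReal_eq_toReal_iff' (by simp) (by simp), ENNReal.toReal_add (by simp) (by simp),
    ENNReal.toReal_add (by simp) (by simp), ENNReal.toReal_ofReal', ENNReal.toReal_ofReal']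
  simp only [ENNReal.coe_toReal]
  rcases le_total (p : ℝ) n with hpn | hpn
  · rw [max_eq_right (by linarith), max_eq_left (by linarith)]; ring
  · rw [max_eq_left (by linarith), max_eq_right (by linarith)]; ring

/-- Additivity of the integral when one summand is nonnegative, possibly with infinite integral,
and the other one is integrable; all terms are arranged so that only sums in `[0, ∞]` occur. -/
lemma lintegral_ofReal_add {α : Type*} [MeasurableSpace α] {μ : Measure α} {a b : α → ℝ}
    (ha : Measurable a) (hb : Integrable b μ) (ha0 : ∀ x, 0 ≤ a x) (hab : ∀ x, 0 ≤ a x + b x) :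
    ∫⁻ x, ENNReal.ofReal (a x + b x) ∂μ + ENNReal.ofReal (-∫ x, b x ∂μ) =
      ∫⁻ x, ENNReal.ofReal (a x) ∂μ + ENNReal.ofReal (∫ x, b x ∂μ) := by
  have h1 : ∫⁻ x, ENNReal.ofReal (b x) ∂μ ≠ ∞ := hb.lintegral_lt_top.ne
  have key : ∫⁻ x, ENNReal.ofReal (a x + b x) ∂μ + ∫⁻ x, ENNReal.ofReal (-b x) ∂μ =
      ∫⁻ x, ENNReal.ofReal (a x) ∂μ + ∫⁻ x, ENNReal.ofReal (b x) ∂μ := by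
    rw [← lintegral_add_right' (g := fun x => ENNReal.ofReal (-b x)) _
        hb.1.aemeasurable.neg.ennreal_ofReal,
      ← lintegral_add_left ha.ennreal_ofReal]
    exact lintegral_congr fun x => ofReal_add_ofReal_neg (ha0 x) (hab x)
  have key2 := ofReal_integral_add_lintegral_neg hb
  rw [← ENNReal.add_left_inj h1, add_assoc, ← key2, add_left_comm, ← add_assoc, add_comm _
    (∫⁻ x, ENNReal.ofReal (a x + b x) ∂μ), add_right_comm, key]
  ring

namespace JumpRates

variable {E : Type*}

/-- The relative entropy rate at the state `x` in nonnegative form,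
`∑_y c'(x, y) φ(c(x, y) / c'(x, y))` with `φ(a) = a log a + 1 - a`. -/
noncomputable def entropyRateAt (c c' : JumpRates E) (x : E) : ℝ≥0∞ :=
  ∑' y, ENNReal.ofReal (c'.rate x y * klFun (c.rate x y / c'.rate x y))

/-- The expected time spent in a state with total rate `l` before time `r`. -/
noncomputable def _root_.meanOccupation (l r : ℝ) : ℝ≥0∞ :=
  ∫⁻ u in Set.Ioc 0 r, ENNReal.ofReal (Real.exp (-(l * u)))

lemma _root_.measurable_meanOccupation (l : ℝ) : Measurable (meanOccupation l) :=
  Monotone.measurable fun _ _ h => lintegral_mono_set (Set.Ioc_subset_Ioc_right h)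

/-- The density of one step of the truncated chain with rates `c` with respect to the one with
rates `c'`. -/
noncomputable def stepDensity (c c' : JumpRates E) (T : ℝ≥0) (z w : E × ℝ≥0∞) : ℝ≥0∞ :=
  open Classical in
  if w.2 = ∞ then
    ENNReal.ofReal (Real.exp (-((c.total z.1 - c'.total z.1) * timeLeft T z.2)))
  else ENNReal.ofReal (c.rate z.1 w.1 / c'.rate z.1 w.1 *
    Real.exp (-((c.total z.1 - c'.total z.1) * (w.2 - z.2).toReal)))

lemma stepDensity_top (c c' : JumpRates E) (T : ℝ≥0) (z : E × ℝ≥0∞) (y : E) :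
    stepDensity c c' T z (y, ∞) =
      ENNReal.ofReal (Real.exp (-((c.total z.1 - c'.total z.1) * timeLeft T z.2))) := if_pos rfl

lemma stepDensity_of_mem_Ioc (c c' : JumpRates E) (T : ℝ≥0) (z : E × ℝ≥0∞) (y : E) {u : ℝ}
    (hu : u ∈ Set.Ioc 0 (timeLeft T z.2)) :
    stepDensity c c' T z (y, z.2 + ENNReal.ofReal u) =
      ENNReal.ofReal (c.rate z.1 y / c'.rate z.1 y *
        Real.exp (-((c.total z.1 - c'.total z.1) * u))) := by
  have hz := ne_top_of_mem_Ioc_timeLeft hu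
  rw [stepDensity, if_neg (ENNReal.add_ne_top.2 ⟨hz, ENNReal.ofReal_ne_top⟩)]
  simp only [toReal_add_ofReal_sub hz hu.1.le]

/-- The entropy density of one step at waiting time `u` splits into the entropy rate of the jump,
times the survival probability, and a correction that is linear in the rates `a` and `a'`, hence
summable over the next states. -/
lemma klFun_mul_exp {a a' l l' u : ℝ} (h : a' = 0 → a = 0) :
    a' * Real.exp (-(l' * u)) * klFun (a / a' * Real.exp (-((l - l') * u))) =
      a' * klFun (a / a') * Real.exp (-(l * u)) +
        (a' * (Real.exp (-(l' * u)) - Real.exp (-(l * u)))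
          - (l - l') * u * a * Real.exp (-(l * u))) := by
  by_cases ha' : a' = 0
  · simp [ha', h ha']
  by_cases ha : a = 0
  · simp [ha, klFun]; ring
  have he : Real.exp (-(l' * u)) * Real.exp (-((l - l') * u)) = Real.exp (-(l * u)) := by
    rw [← Real.exp_add]; congr 1; ring
  have hl : Real.log (a / a' * Real.exp (-((l - l') * u))) =
      Real.log (a / a') - (l - l') * u := by
    rw [Real.log_mul (div_ne_zero ha ha') (Real.exp_pos _).ne', Real.log_exp]; ring
  have e1 : a' * (a / a') = a := mul_div_cancel₀ _ ha'
  simp only [klFun]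
  rw [hl]
  have : a' * Real.exp (-(l' * u)) * (a / a' * Real.exp (-((l - l') * u)) *
      (Real.log (a / a') - (l - l') * u) + 1 - a / a' * Real.exp (-((l - l') * u))) =
      (a' * (a / a')) * (Real.exp (-(l' * u)) * Real.exp (-((l - l') * u))) *
        (Real.log (a / a') - (l - l') * u - 1) + a' * Real.exp (-(l' * u)) := by ring
  rw [this, he]
  have : a' * (a / a' * Real.log (a / a') + 1 - a / a') =
      (a' * (a / a')) * (Real.log (a / a') - 1) + a' := by ring
  rw [this, e1]
  ring

variable [MeasurableSpace E] [DiscreteMeasurableSpace E] [Countable E]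

lemma measurable_stepDensity (c c' : JumpRates E) (T : ℝ≥0) :
    Measurable (Function.uncurry (stepDensity c c' T)) := by
  classical
  have h1 : Measurable c.total := measurable_of_countable _
  have h2 : Measurable c'.total := measurable_of_countable _
  have h3 : Measurable fun p : E × E => c.rate p.1 p.2 / c'.rate p.1 p.2 :=
    measurable_of_countable _
  have h4 : Measurable fun p : (E × ℝ≥0∞) × (E × ℝ≥0∞) =>
      c.rate p.1.1 p.2.1 / c'.rate p.1.1 p.2.1 :=
    h3.comp (g := fun p : E × E => c.rate p.1 p.2 / c'.rate p.1 p.2)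
      (f := fun p : (E × ℝ≥0∞) × (E × ℝ≥0∞) => (p.1.1, p.2.1)) (by fun_prop)
  unfold stepDensity Function.uncurry
  exact Measurable.ite (measurableSet_eq_fun (measurable_snd.comp measurable_snd) measurable_const)
    (by fun_prop) (by fun_prop)

lemma truncKernel_eq_withDensity (c c' : JumpRates E) (T : ℝ≥0)
    (hc : ∀ x y, c'.rate x y = 0 → c.rate x y = 0) (z : E × ℝ≥0∞) :
    c.truncKernel T z = (c'.truncKernel T z).withDensity (stepDensity c c' T z) := by
  have hm : Measurable (stepDensity c c' T z) := (measurable_stepDensity c c' T).of_uncurry_left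
  refine Measure.ext_of_lintegral _ fun f hf => ?_
  rw [lintegral_withDensity_eq_lintegral_mul _ hm hf, lintegral_truncKernel _ _ _ hf,
    lintegral_truncKernel _ _ _ (hm.mul hf)]
  congr 1
  · rw [Pi.mul_apply, stepDensity_top, ← mul_assoc, ← ENNReal.ofReal_mul (Real.exp_pos _).le,
      ← Real.exp_add]
    congr 3
    ring
  · refine setLIntegral_congr_fun measurableSet_Ioc fun u hu => tsum_congr fun y => ?_
    rw [Pi.mul_apply, stepDensity_of_mem_Ioc c c' T z y hu, ← mul_assoc, ← ENNReal.ofReal_mul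
      (mul_nonneg (c'.rate_nonneg _ _) (Real.exp_pos _).le)]
    congr 2
    by_cases h : c'.rate z.1 y = 0
    · simp [h, hc _ _ h]
    · rw [mul_mul_mul_comm, mul_div_cancel₀ _ h, ← Real.exp_add]
      congr 2
      ring

lemma tsum_ofReal_klFun_step (c c' : JumpRates E) (hc : ∀ x y, c'.rate x y = 0 → c.rate x y = 0)
    (x : E) (u : ℝ) :
    ∑' y, ENNReal.ofReal (c'.rate x y * Real.exp (-(c'.total x * u)) *
        klFun (c.rate x y / c'.rate x y * Real.exp (-((c.total x - c'.total x) * u)))) +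
      ENNReal.ofReal (-(c'.total x * (Real.exp (-(c'.total x * u)) - Real.exp (-(c.total x * u)))
          - (c.total x - c'.total x) * u * c.total x * Real.exp (-(c.total x * u)))) =
      entropyRateAt c c' x * ENNReal.ofReal (Real.exp (-(c.total x * u))) +
      ENNReal.ofReal (c'.total x * (Real.exp (-(c'.total x * u)) - Real.exp (-(c.total x * u)))
          - (c.total x - c'.total x) * u * c.total x * Real.exp (-(c.total x * u))) := by
  set l := c.total x
  set l' := c'.total x
  set b : E → ℝ := fun y => c'.rate x y * (Real.exp (-(l' * u)) - Real.exp (-(l * u)))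
    - (l - l') * u * c.rate x y * Real.exp (-(l * u)) with hb
  have hs1 : Summable fun y => c'.rate x y * (Real.exp (-(l' * u)) - Real.exp (-(l * u))) :=
    (c'.summable_rate x).mul_right _
  have hs2 : Summable fun y => (l - l') * u * c.rate x y * Real.exp (-(l * u)) :=
    ((c.summable_rate x).mul_left _).mul_right _
  have hbs : Summable b := hs1.sub hs2
  have hbt : ∑' y, b y = l' * (Real.exp (-(l' * u)) - Real.exp (-(l * u)))
      - (l - l') * u * l * Real.exp (-(l * u)) := by
    rw [hb, hs1.tsum_sub hs2, tsum_mul_right, tsum_mul_right, tsum_mul_left]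
    rfl
  have hbi : Integrable b Measure.count := integrable_count_iff.2 hbs.norm
  have hbint : ∫ y, b y ∂Measure.count = ∑' y, b y := by
    rw [integral_countable hbi]
    simp
  have key := lintegral_ofReal_add (μ := Measure.count)
    (a := fun y => c'.rate x y * klFun (c.rate x y / c'.rate x y) * Real.exp (-(l * u)))
    (b := b) (measurable_of_countable _) hbi (fun y => ?_) (fun y => ?_)
  · rw [hbint, hbt, lintegral_count, lintegral_count] at key
    convert key using 2
    · refine tsum_congr fun y => ?_
      rw [klFun_mul_exp (hc x y)]
    · rw [entropyRateAt, ← ENNReal.tsum_mul_right]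
      refine tsum_congr fun y => ?_
      rw [ENNReal.ofReal_mul' (Real.exp_pos _).le]
  · exact mul_nonneg (mul_nonneg (c'.rate_nonneg _ _)
      (klFun_nonneg (div_nonneg (c.rate_nonneg _ _) (c'.rate_nonneg _ _)))) (Real.exp_pos _).le
  · rw [hb, ← klFun_mul_exp (hc x y)]
    exact mul_nonneg (mul_nonneg (c'.rate_nonneg _ _) (Real.exp_pos _).le)
      (klFun_nonneg (mul_nonneg (div_nonneg (c.rate_nonneg _ _) (c'.rate_nonneg _ _))
        (Real.exp_pos _).le))

/-- The relative entropy of one step from `(x, s)` is the local entropy rate times the expected time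
that the chain spends in `x` before it leaves `x` or the window ends. -/
lemma lintegral_klFun_stepDensity (c c' : JumpRates E) (T : ℝ≥0)
    (hc : ∀ x y, c'.rate x y = 0 → c.rate x y = 0) (z : E × ℝ≥0∞) :
    ∫⁻ w, ENNReal.ofReal (klFun (stepDensity c c' T z w).toReal) ∂c'.truncKernel T z =
      entropyRateAt c c' z.1 * meanOccupation (c.total z.1) (timeLeft T z.2) := by
  have hm : Measurable (stepDensity c c' T z) := (measurable_stepDensity c c' T).of_uncurry_left
  have hm' : Measurable fun w => ENNReal.ofReal (klFun (stepDensity c c' T z w).toReal) :=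
    (measurable_klFun.comp hm.ennreal_toReal).ennreal_ofReal
  rw [lintegral_truncKernel _ _ _ hm']
  set r := timeLeft T z.2
  have hr : 0 ≤ r := timeLeft_nonneg _ _
  set l := c.total z.1 with hl
  set l' := c'.total z.1 with hl'
  rw [stepDensity_top, ENNReal.toReal_ofReal (Real.exp_pos _).le,
    ← ENNReal.ofReal_mul (Real.exp_pos _).le, ← hl, ← hl']
  have hcongr : ∫⁻ u in Set.Ioc 0 r, ∑' y, ENNReal.ofReal (c'.rate z.1 y * Real.exp (-(l' * u))) *
      ENNReal.ofReal (klFun (stepDensity c c' T z (y, z.2 + ENNReal.ofReal u)).toReal) =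
      ∫⁻ u in Set.Ioc 0 r, ∑' y, ENNReal.ofReal (c'.rate z.1 y * Real.exp (-(l' * u)) *
        klFun (c.rate z.1 y / c'.rate z.1 y * Real.exp (-((l - l') * u)))) := by
    refine setLIntegral_congr_fun measurableSet_Ioc fun u hu => tsum_congr fun y => ?_
    rw [stepDensity_of_mem_Ioc c c' T z y hu, ENNReal.toReal_ofReal
      (mul_nonneg (div_nonneg (c.rate_nonneg _ _) (c'.rate_nonneg _ _)) (Real.exp_pos _).le),
      ENNReal.ofReal_mul (mul_nonneg (c'.rate_nonneg _ _) (Real.exp_pos _).le)]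
  rw [hcongr]
  -- `β` sums the corrections in `klFun_mul_exp` over the next states; its integral cancels the
  -- entropy of the event that the window ends before the jump.
  set β : ℝ → ℝ := fun u => l' * (Real.exp (-(l' * u)) - Real.exp (-(l * u)))
    - (l - l') * u * l * Real.exp (-(l * u)) with hβ
  have hβc : Continuous β := by fun_prop
  have hβi : Integrable β (volume.restrict (Set.Ioc 0 r)) := hβc.integrableOn_Ioc
  have hβint : ∫ u in Set.Ioc 0 r, β u =
      -(Real.exp (-(l' * r)) * klFun (Real.exp (-((l - l') * r)))) := by
    have hd : ∀ u ∈ Set.uIcc 0 r, HasDerivAt (fun u => (l - l') * u * Real.exp (-(l * u))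
        + Real.exp (-(l * u)) - Real.exp (-(l' * u))) (β u) u := fun u _ => by
      have he : ∀ a : ℝ, HasDerivAt (fun u => Real.exp (-(a * u))) (Real.exp (-(a * u)) * -a) u :=
        fun a => by simpa using (((hasDerivAt_id u).const_mul a).neg).exp
      convert! ((((hasDerivAt_id u).const_mul (l - l')).mul (he l)).add (he l)).sub (he l') using 1
      simp only [hβ, id]
      ring
    rw [← intervalIntegral.integral_of_le hr, intervalIntegral.integral_eq_sub_of_hasDerivAt hd
      (hβc.intervalIntegrable _ _), klFun, Real.log_exp]
    have he : Real.exp (-(l' * r)) * Real.exp (-((l - l') * r)) = Real.exp (-(l * r)) := by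
      rw [← Real.exp_add]; congr 1; ring
    rw [← he]
    simp
    ring
  have hκ : 0 ≤ Real.exp (-(l' * r)) * klFun (Real.exp (-((l - l') * r))) :=
    mul_nonneg (Real.exp_pos _).le (klFun_nonneg (Real.exp_pos _).le)
  have key := ofReal_integral_add_lintegral_neg hβi
  rw [hβint, neg_neg, ENNReal.ofReal_of_nonpos (neg_nonpos.2 hκ), zero_add] at key
  have hfin : ∫⁻ u in Set.Ioc 0 r, ENNReal.ofReal (β u) ≠ ∞ := hβi.lintegral_lt_top.ne
  rw [← ENNReal.add_left_inj hfin, add_right_comm, ← key, add_comm,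
    ← lintegral_add_right (g := fun u => ENNReal.ofReal (-β u)) _
      hβc.measurable.neg.ennreal_ofReal,
    meanOccupation, ← lintegral_const_mul _ (by fun_prop),
    ← lintegral_add_right _ hβc.measurable.ennreal_ofReal]
  exact lintegral_congr fun u => tsum_ofReal_klFun_step c c' hc z.1 u

end JumpRates

/-! ### Survival and admissible transitions of the truncated chain -/

/-- The probability that a chain which entered a state of total rate `l` at time `s` is still in it
at time `v`, set to `0` for `v < s`. -/
noncomputable def survival (l : ℝ) (s v : ℝ≥0∞) : ℝ≥0∞ :=
  (Set.Ici s).indicator (fun v => ENNReal.ofReal (Real.exp (-(l * (v - s).toReal)))) v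

lemma survival_of_le (l : ℝ) {s v : ℝ≥0∞} (h : s ≤ v) :
    survival l s v = ENNReal.ofReal (Real.exp (-(l * (v - s).toReal))) :=
  Set.indicator_of_mem (Set.mem_Ici.2 h) _

lemma survival_of_lt (l : ℝ) {s v : ℝ≥0∞} (h : v < s) : survival l s v = 0 :=
  Set.indicator_of_notMem (fun h' => absurd (Set.mem_Ici.1 h') h.not_ge) _

@[fun_prop]
lemma measurable_survival : Measurable fun p : ℝ × ℝ≥0∞ × ℝ≥0∞ => survival p.1 p.2.1 p.2.2 := by
  classical
  simp only [survival, Set.indicator, Set.mem_Ici]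
  exact Measurable.ite (measurableSet_le (measurable_fst.comp measurable_snd)
    (measurable_snd.comp measurable_snd)) (by fun_prop) measurable_const

lemma lintegral_survival (T : ℝ≥0) (l : ℝ) (s : ℝ≥0∞) :
    ∫⁻ t in Set.Ioc 0 (T : ℝ), survival l s (ENNReal.ofReal t) =
      meanOccupation l (timeLeft T s) := by
  unfold survival
  rcases lt_or_ge (T : ℝ≥0∞) s with hT | hT
  · rw [timeLeft_of_lt hT, meanOccupation, Set.Ioc_self, Measure.restrict_empty,
      lintegral_zero_measure]
    refine (setLIntegral_congr_fun (g := fun _ => 0) measurableSet_Ioc fun t ht => ?_).trans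
      lintegral_zero
    refine Set.indicator_of_notMem (fun h => ?_) _
    have : ENNReal.ofReal t ≤ T := by
      rw [← ENNReal.ofReal_coe_nnreal]; exact ENNReal.ofReal_le_ofReal ht.2
    exact absurd hT (not_lt.2 (le_trans h this))
  · have hs : s ≠ ∞ := ne_top_of_le_ne_top ENNReal.coe_ne_top hT
    rw [timeLeft_eq_sub hT, meanOccupation, ← lintegral_indicator measurableSet_Ioc,
      ← lintegral_indicator measurableSet_Ioc,
      ← lintegral_sub_right_eq_self (μ := volume) ((Set.Ioc 0 (T - s.toReal)).indicator
        fun u => ENNReal.ofReal (Real.exp (-(l * u)))) s.toReal]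
    refine lintegral_congr_ae ?_
    filter_upwards [Measure.ae_ne volume s.toReal] with t ht
    have hs0 : 0 ≤ s.toReal := ENNReal.toReal_nonneg
    by_cases h : t ∈ Set.Ioc s.toReal T
    · have h1 : t ∈ Set.Ioc 0 (T : ℝ) := ⟨hs0.trans_lt h.1, h.2⟩
      have h2 : t - s.toReal ∈ Set.Ioc 0 (T - s.toReal) := ⟨sub_pos.2 h.1, sub_le_sub_right h.2 _⟩
      have h3 : ENNReal.ofReal t ∈ Set.Ici s :=
        (ENNReal.le_ofReal_iff_toReal_le hs h1.1.le).2 h.1.le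
      rw [Set.indicator_of_mem h1, Set.indicator_of_mem h2, Set.indicator_of_mem h3,
        ENNReal.toReal_sub_of_le h3 ENNReal.ofReal_ne_top, ENNReal.toReal_ofReal h1.1.le]
    · have h2 : t - s.toReal ∉ Set.Ioc 0 (T - s.toReal) := fun h2 =>
        h ⟨sub_pos.1 h2.1, (sub_le_sub_iff_right _).1 h2.2⟩
      rw [Set.indicator_of_notMem h2]
      by_cases h1 : t ∈ Set.Ioc 0 (T : ℝ)
      · rw [Set.indicator_of_mem h1, Set.indicator_of_notMem]
        intro h3
        have := (ENNReal.le_ofReal_iff_toReal_le hs h1.1.le).1 h3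
        exact h ⟨lt_of_le_of_ne this ht.symm, h1.2⟩
      · rw [Set.indicator_of_notMem h1]

/-- The pairs of successive positions that occur almost surely in the truncated chain: the window
ends, or a jump to another state happens at a strictly later time within it. -/
def IsTruncTransition {E : Type*} (T : ℝ≥0) (z w : E × ℝ≥0∞) : Prop :=
  (w.2 = ∞ ∧ w.1 = z.1) ∨ (z.2 < w.2 ∧ w.2 ≤ T ∧ w.1 ≠ z.1)

namespace JumpRates

variable {E : Type*} [MeasurableSpace E] [DiscreteMeasurableSpace E] [Countable E]

lemma _root_.measurableSet_isTruncTransition (T : ℝ≥0) :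
    MeasurableSet {p : (E × ℝ≥0∞) × (E × ℝ≥0∞) | IsTruncTransition T p.1 p.2} := by
  have h : MeasurableSet {p : (E × ℝ≥0∞) × (E × ℝ≥0∞) | p.2.1 = p.1.1} :=
    (Set.to_countable {q : E × E | q.2 = q.1}).measurableSet.preimage
      (f := fun p : (E × ℝ≥0∞) × (E × ℝ≥0∞) => (p.1.1, p.2.1)) (by fun_prop)
  refine MeasurableSet.union (MeasurableSet.inter ?_ h) (MeasurableSet.inter ?_
    (MeasurableSet.inter ?_ h.compl))
  · exact measurableSet_eq_fun (measurable_snd.comp measurable_snd) measurable_const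
  · exact measurableSet_lt (measurable_snd.comp measurable_fst) (measurable_snd.comp measurable_snd)
  · exact measurableSet_le (measurable_snd.comp measurable_snd) measurable_const

lemma truncKernel_survival (c : JumpRates E) {T t : ℝ≥0} (ht : t ≤ T) {z : E × ℝ≥0∞}
    (hz : z.2 ≤ t) :
    c.truncKernel T z {w | (t : ℝ≥0∞) < w.2} = survival (c.total z.1) z.2 t := by
  rw [survival_of_le _ hz]
  have hm : MeasurableSet {w : E × ℝ≥0∞ | (t : ℝ≥0∞) < w.2} :=
    measurableSet_lt measurable_const measurable_snd
  have htT : (t : ℝ≥0∞) ≤ T := by exact_mod_cast ht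
  have hiff : ∀ q : ℝ≥0∞ × E, truncStep T z q ∈ {w : E × ℝ≥0∞ | (t : ℝ≥0∞) < w.2} ↔
      q ∈ Set.Ioi ((t : ℝ≥0∞) - z.2) ×ˢ (Set.univ : Set E) := by
    intro q
    have hz' : z.2 ≠ ∞ := ne_top_of_le_ne_top ENNReal.coe_ne_top hz
    have : (t : ℝ≥0∞) - z.2 < q.1 ↔ (t : ℝ≥0∞) < z.2 + q.1 := by
      rw [(ENNReal.cancel_of_ne hz').tsub_lt_iff_left hz]
    simp only [Set.mem_prod, Set.mem_Ioi, Set.mem_univ, and_true, this, Set.mem_ofPred_eq]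
    rcases le_or_gt (z.2 + q.1) T with h | h
    · rw [truncStep_of_le h]
    · rw [truncStep_of_lt h]
      simp [htT.trans_lt h]
  rw [← lintegral_indicator_one hm, lintegral_truncKernel_eq_clockKernel c T z
    (measurable_one.indicator hm), ← holdingLaw_Ioi c z.1 (by simp)]
  have : ∀ q, Set.indicator {w : E × ℝ≥0∞ | (t : ℝ≥0∞) < w.2} (1 : E × ℝ≥0∞ → ℝ≥0∞)
      (truncStep T z q) = Set.indicator (Set.Ioi ((t : ℝ≥0∞) - z.2) ×ˢ (Set.univ : Set E)) 1 q :=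
    fun q => by
      by_cases h : truncStep T z q ∈ {w : E × ℝ≥0∞ | (t : ℝ≥0∞) < w.2}
      · rw [Set.indicator_of_mem h, Set.indicator_of_mem ((hiff q).1 h)]; rfl
      · rw [Set.indicator_of_notMem h, Set.indicator_of_notMem fun h' => h ((hiff q).2 h')]
  rw [lintegral_congr this, lintegral_indicator_one (measurableSet_Ioi.prod .univ), clockKernel,
    Kernel.prod_apply_prod, measure_univ, mul_one]
  rfl

lemma ae_isTruncTransition (c : JumpRates E) (T : ℝ≥0) (z : E × ℝ≥0∞) :
    ∀ᵐ w ∂c.truncKernel T z, IsTruncTransition T z w := by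
  have hm : MeasurableSet {w : E × ℝ≥0∞ | ¬ IsTruncTransition T z w} :=
    ((measurableSet_isTruncTransition T).preimage
      ((measurable_const (a := z)).prodMk measurable_id)).compl
  rw [ae_iff, ← lintegral_indicator_one hm,
    lintegral_truncKernel _ _ _ (measurable_one.indicator hm)]
  have h0 : ¬ ¬ IsTruncTransition T z (z.1, ∞) := not_not.2 (Or.inl ⟨rfl, rfl⟩)
  rw [Set.indicator_of_notMem (by exact h0), mul_zero, zero_add]
  refine (setLIntegral_congr_fun (g := fun _ => 0) measurableSet_Ioc fun u hu => ?_).trans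
    lintegral_zero
  refine ENNReal.tsum_eq_zero.2 fun y => ?_
  by_cases hy : y = z.1
  · simp [hy, c.rate_self]
  · have hz := ne_top_of_mem_Ioc_timeLeft hu
    have hT : z.2 ≤ T := by
      by_contra! h
      rw [timeLeft_of_lt h] at hu
      exact absurd hu.1 (not_lt.2 hu.2)
    have h1 : IsTruncTransition T z (y, z.2 + ENNReal.ofReal u) :=
      Or.inr ⟨ENNReal.lt_add_right hz (ENNReal.ofReal_pos.2 hu.1).ne',
        (add_ofReal_le_iff hT).2 hu.2, hy⟩
    rw [Set.indicator_of_notMem (by simpa using h1), mul_zero]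

end JumpRates

/-! ### The truncated chain as a function of the skeleton -/

/-- The truncated chain along a skeleton `ω`: the pairs of the state after the `n`-th jump and its
time, as long as this time is at most `T`. -/
noncomputable def truncChain {E : Type*} (T : ℝ≥0) (ω : ℕ → E × ℝ≥0∞) : ℕ → E × ℝ≥0∞
  | 0 => ((ω 0).1, 0)
  | n + 1 => truncStep T (truncChain T ω n) ((ω n).2, (ω (n + 1)).1)

/-- The truncated chain stopped after `n` steps. -/
noncomputable def stoppedChain {E : Type*} (T : ℝ≥0) (n : ℕ) (ω : ℕ → E × ℝ≥0∞) :
    ℕ → E × ℝ≥0∞ := fun i => truncChain T ω (min i n)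

section Chain

variable {E : Type*} {T : ℝ≥0} {ω ω' : ℕ → E × ℝ≥0∞}

lemma truncChain_congr {n : ℕ} (h : ∀ i < n, ω i = ω' i) (hn : (ω n).1 = (ω' n).1) :
    ∀ i ≤ n, truncChain T ω i = truncChain T ω' i := by
  intro i hi
  have hfst : ∀ j ≤ n, (ω j).1 = (ω' j).1 := fun j hj => by
    rcases hj.lt_or_eq with hj | rfl
    · rw [h j hj]
    · exact hn
  induction i with
  | zero => simp [truncChain, hfst 0 n.zero_le]
  | succ i ih => rw [truncChain, truncChain, ih (by omega), h i (by omega), hfst _ hi]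

lemma stoppedChain_congr {n : ℕ} (h : ∀ i < n, ω i = ω' i) (hn : (ω n).1 = (ω' n).1) :
    stoppedChain T n ω = stoppedChain T n ω' :=
  funext fun i => truncChain_congr h hn _ (min_le_right i n)

lemma jumpTime_succ (ω : ℕ → E × ℝ≥0∞) (n : ℕ) :
    jumpTime ω (n + 1) = jumpTime ω n + (ω n).2 := Finset.sum_range_succ _ _

lemma jumpTime_mono (ω : ℕ → E × ℝ≥0∞) : Monotone (jumpTime ω) :=
  monotone_nat_of_le_succ fun n => by rw [jumpTime_succ]; exact le_self_add

lemma truncChain_of_le {n : ℕ} (h : jumpTime ω n ≤ T) :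
    truncChain T ω n = ((ω n).1, jumpTime ω n) := by
  induction n with
  | zero => simp [truncChain, jumpTime]
  | succ n ih =>
    have hn := ih ((jumpTime_mono ω n.le_succ).trans h)
    rw [jumpTime_succ] at h
    rw [truncChain, hn, truncStep_of_le h, jumpTime_succ]

lemma truncChain_snd_of_lt {n : ℕ} (h : T < jumpTime ω n) : (truncChain T ω n).2 = ∞ := by
  induction n with
  | zero => simp [jumpTime] at h
  | succ n ih =>
    rcases le_or_gt (jumpTime ω n) T with hn | hn
    · rw [jumpTime_succ] at h
      rw [truncChain, truncChain_of_le hn, truncStep_of_lt h]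
    · rw [truncChain, truncStep_of_lt]
      simp [ih hn]

lemma truncChain_succ_of_snd_eq_top {n : ℕ} (h : (truncChain T ω n).2 = ∞) :
    truncChain T ω (n + 1) = truncChain T ω n := by
  rw [truncChain, truncStep_of_lt (by simp [h]), ← h]

lemma truncChain_of_snd_eq_top {n m : ℕ} (h : (truncChain T ω n).2 = ∞) (hnm : n ≤ m) :
    truncChain T ω m = truncChain T ω n := by
  induction m, hnm using Nat.le_induction with
  | base => rfl
  | succ m _ ih => rw [truncChain_succ_of_snd_eq_top (ih ▸ h), ih]

lemma truncChain_mem_Ico_iff {t : ℝ≥0} (ht : t ≤ T) (n : ℕ) :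
    ((truncChain T ω n).2 ≤ t ∧ (t : ℝ≥0∞) < (truncChain T ω (n + 1)).2) ↔
      (jumpTime ω n ≤ t ∧ (t : ℝ≥0∞) < jumpTime ω (n + 1)) := by
  have htT : (t : ℝ≥0∞) ≤ T := by exact_mod_cast ht
  have h1 : ∀ n, (truncChain T ω n).2 ≤ t ↔ jumpTime ω n ≤ t := fun n => by
    rcases le_or_gt (jumpTime ω n) T with hn | hn
    · rw [truncChain_of_le hn]
    · rw [truncChain_snd_of_lt hn]
      simp [htT.trans_lt hn]
  rw [h1, ← not_le, ← not_le, h1]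

variable [MeasurableSpace E]

@[fun_prop]
lemma measurable_truncChain (T : ℝ≥0) (n : ℕ) :
    Measurable fun ω : ℕ → E × ℝ≥0∞ => truncChain T ω n := by
  induction n with
  | zero => unfold truncChain; fun_prop
  | succ n ih =>
    exact (measurable_truncStep T).comp (ih.prodMk (by fun_prop))

@[fun_prop]
lemma measurable_stoppedChain (T : ℝ≥0) (n : ℕ) :
    Measurable (stoppedChain (E := E) T n) :=
  measurable_pi_lambda _ fun i => measurable_truncChain T (min i n)

end Chain

/-! ### Markov property of the truncated chain -/

section

variable {E : Type*}

/-- A skeleton with prescribed first `n + 1` terms and prescribed `(n + 1)`-st state. -/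
noncomputable def extendSkeleton (n : ℕ) (h : (_ : Finset.Iic n) → E × ℝ≥0∞) (y : E) :
    ℕ → E × ℝ≥0∞ := fun i => if hi : i ≤ n then h ⟨i, Finset.mem_Iic.2 hi⟩ else (y, 0)

lemma stoppedChain_extendSkeleton_succ (T : ℝ≥0) (n : ℕ) (ω : ℕ → E × ℝ≥0∞) :
    stoppedChain T (n + 1) (extendSkeleton n (Preorder.frestrictLe n ω) (ω (n + 1)).1) =
      stoppedChain T (n + 1) ω := by
  refine stoppedChain_congr (fun i hi => ?_) ?_
  · simp [extendSkeleton, Nat.lt_succ_iff.1 hi]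
  · simp [extendSkeleton]

lemma stoppedChain_extendSkeleton (T : ℝ≥0) (n : ℕ) (ω : ℕ → E × ℝ≥0∞) (y : E) :
    stoppedChain T n (extendSkeleton n (Preorder.frestrictLe n ω) y) = stoppedChain T n ω := by
  refine stoppedChain_congr (fun i hi => ?_) ?_
  · simp [extendSkeleton, hi.le]
  · simp [extendSkeleton]

lemma measurable_extendSkeleton [MeasurableSpace E] (n : ℕ) :
    Measurable fun p : ((_ : Finset.Iic n) → E × ℝ≥0∞) × E => extendSkeleton n p.1 p.2 := by
  refine measurable_pi_lambda _ fun i => ?_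
  unfold extendSkeleton
  split_ifs <;> fun_prop

end

namespace JumpRates

variable {E : Type*} [MeasurableSpace E] [DiscreteMeasurableSpace E] [Countable E]

instance (c : JumpRates E) (μ : Measure E) [IsProbabilityMeasure μ] :
    IsProbabilityMeasure (c.skeletonLaw μ) := by
  unfold skeletonLaw; infer_instance

lemma map_zero_skeletonLaw (c : JumpRates E) (μ : Measure E) [IsProbabilityMeasure μ] :
    (c.skeletonLaw μ).map (fun ω => ω 0) = μ ⊗ₘ c.holdingKernel := by
  have h : (fun ω : ℕ → E × ℝ≥0∞ => ω 0) =
      (fun h : (i : Finset.Iic 0) → E × ℝ≥0∞ => h ⟨0, Finset.mem_Iic.2 le_rfl⟩) ∘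
        Preorder.frestrictLe 0 := rfl
  rw [h, ← Measure.map_map (by fun_prop) (by fun_prop), skeletonLaw, Kernel.trajMeasure,
    Measure.map_comp _ _ (by fun_prop), Kernel.traj_map_frestrictLe, Kernel.partialTraj_self,
    Measure.id_comp, Measure.map_map (by fun_prop) (by fun_prop)]
  exact Measure.map_id

lemma lintegral_skeletonLaw_succ (c : JumpRates E) (μ : Measure E) [IsProbabilityMeasure μ] (n : ℕ)
    {f : ((_ : Finset.Iic n) → E × ℝ≥0∞) × (E × ℝ≥0∞) → ℝ≥0∞} (hf : Measurable f) :
    ∫⁻ ω, f (Preorder.frestrictLe n ω, ω (n + 1)) ∂c.skeletonLaw μ =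
      ∫⁻ ω, ∫⁻ y, ∫⁻ τ, f (Preorder.frestrictLe n ω, (y, τ)) ∂c.holdingKernel y
        ∂c.jumpKernel (ω n).1 ∂c.skeletonLaw μ := by
  have key := Kernel.map_frestrictLe_trajMeasure_compProd_eq_map_trajMeasure
    (X := fun _ => E × ℝ≥0∞) (μ₀ := μ ⊗ₘ c.holdingKernel) (κ := c.stepKernel) (a := n)
  have h1 : ∫⁻ ω, f (Preorder.frestrictLe n ω, ω (n + 1)) ∂c.skeletonLaw μ =
      ∫⁻ p, f p ∂((c.skeletonLaw μ).map fun x => (Preorder.frestrictLe n x, x (n + 1))) := by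
    rw [lintegral_map hf (by fun_prop)]
  rw [h1, skeletonLaw, ← key, Measure.lintegral_compProd hf,
    lintegral_map (Measurable.lintegral_kernel_prod_right' hf) (by fun_prop)]
  refine lintegral_congr fun ω => ?_
  rw [stepKernel, Kernel.comap_apply, Kernel.lintegral_compProd _ _ _ (by fun_prop)]
  rfl

/-- Given the truncated chain up to step `n` and the `n`-th state, the waiting time in this state
has its holding law. -/
lemma lintegral_stoppedChain_holding (c : JumpRates E) (μ : Measure E) [IsProbabilityMeasure μ]
    (T : ℝ≥0) (n : ℕ) {f : (ℕ → E × ℝ≥0∞) × E × ℝ≥0∞ → ℝ≥0∞} (hf : Measurable f) :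
    ∫⁻ ω, f (stoppedChain T n ω, ω n) ∂c.skeletonLaw μ =
      ∫⁻ ω, ∫⁻ τ, f (stoppedChain T n ω, (ω n).1, τ) ∂c.holdingKernel (ω n).1
        ∂c.skeletonLaw μ := by
  have hint : ∀ {α : Type _} [MeasurableSpace α] {g : α × E × ℝ≥0∞ → ℝ≥0∞}, Measurable g →
      Measurable fun p : α × E => ∫⁻ τ, g (p.1, p.2, τ) ∂c.holdingKernel p.2 := by
    intro α _ g hg
    have := Measurable.lintegral_kernel_prod_right'
      (κ := c.holdingKernel.comap (Prod.snd : α × E → E) measurable_snd)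
      (f := fun q : (α × E) × ℝ≥0∞ => g (q.1.1, q.1.2, q.2)) (by fun_prop)
    exact this
  cases n with
  | zero =>
    have h0 : ∀ ω : ℕ → E × ℝ≥0∞, stoppedChain T 0 ω = fun _ => ((ω 0).1, 0) := fun ω => by
      funext i
      simp [stoppedChain, truncChain]
    have hg : Measurable fun p : E × ℝ≥0∞ => f (fun _ => (p.1, 0), p) := by fun_prop
    have hl : ∫⁻ ω, f (stoppedChain T 0 ω, ω 0) ∂c.skeletonLaw μ =
        ∫⁻ p, f (fun _ => (p.1, 0), p) ∂((c.skeletonLaw μ).map fun ω => ω 0) := by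
      rw [lintegral_map hg (by fun_prop)]
      exact lintegral_congr fun ω => by rw [h0]
    have hr : ∫⁻ ω, ∫⁻ τ, f (stoppedChain T 0 ω, (ω 0).1, τ) ∂c.holdingKernel (ω 0).1
        ∂c.skeletonLaw μ = ∫⁻ p, ∫⁻ τ, f (fun _ => (p.1, 0), p.1, τ) ∂c.holdingKernel p.1
          ∂((c.skeletonLaw μ).map fun ω => ω 0) := by
      rw [lintegral_map _ (by fun_prop)]
      · exact lintegral_congr fun ω => by rw [h0]
      · exact (measurable_of_countable
          (fun x => ∫⁻ τ, f (fun _ => (x, 0), x, τ) ∂c.holdingKernel x)).comp measurable_fst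
    rw [hl, hr, map_zero_skeletonLaw, Measure.lintegral_compProd hg, Measure.lintegral_compProd]
    · simp
    · exact (measurable_of_countable
          (fun x => ∫⁻ τ, f (fun _ => (x, 0), x, τ) ∂c.holdingKernel x)).comp measurable_fst
  | succ n =>
    have hα : Measurable fun p : ((_ : Finset.Iic n) → E × ℝ≥0∞) × (E × ℝ≥0∞) =>
        stoppedChain T (n + 1) (extendSkeleton n p.1 p.2.1) :=
      (measurable_stoppedChain T (n + 1)).comp ((measurable_extendSkeleton n).comp
        (f := fun p : ((_ : Finset.Iic n) → E × ℝ≥0∞) × (E × ℝ≥0∞) => (p.1, p.2.1)) (by fun_prop))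
    have e1 := c.lintegral_skeletonLaw_succ μ n
      (f := fun p => f (stoppedChain T (n + 1) (extendSkeleton n p.1 p.2.1), p.2)) (by fun_prop)
    have e2 := c.lintegral_skeletonLaw_succ μ n
      (f := fun p => ∫⁻ τ, f (stoppedChain T (n + 1) (extendSkeleton n p.1 p.2.1), p.2.1, τ)
        ∂c.holdingKernel p.2.1) ((hint hf).comp
          (f := fun p : ((_ : Finset.Iic n) → E × ℝ≥0∞) × (E × ℝ≥0∞) =>
            (stoppedChain T (n + 1) (extendSkeleton n p.1 p.2.1), p.2.1)) (by fun_prop))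
    simp only [stoppedChain_extendSkeleton_succ] at e1 e2
    rw [e1, e2]
    refine lintegral_congr fun ω => lintegral_congr fun y => ?_
    simp

/-- Given the truncated chain up to step `n` and the `n`-th state, the waiting time and the next
state are independent, with the holding law and the jump law of this state. -/
lemma lintegral_stoppedChain_clock (c : JumpRates E) (μ : Measure E) [IsProbabilityMeasure μ]
    (T : ℝ≥0) (n : ℕ) {f : (ℕ → E × ℝ≥0∞) × (ℝ≥0∞ × E) → ℝ≥0∞} (hf : Measurable f) :
    ∫⁻ ω, f (stoppedChain T n ω, ((ω n).2, (ω (n + 1)).1)) ∂c.skeletonLaw μ =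
      ∫⁻ ω, ∫⁻ q, f (stoppedChain T n ω, q) ∂c.clockKernel (ω n).1 ∂c.skeletonLaw μ := by
  have hα : Measurable fun p : ((_ : Finset.Iic n) → E × ℝ≥0∞) × (E × ℝ≥0∞) =>
      stoppedChain T n (extendSkeleton n p.1 p.2.1) :=
    (measurable_stoppedChain T n).comp ((measurable_extendSkeleton n).comp
      (f := fun p : ((_ : Finset.Iic n) → E × ℝ≥0∞) × (E × ℝ≥0∞) => (p.1, p.2.1)) (by fun_prop))
  have e1 := c.lintegral_skeletonLaw_succ μ n
    (f := fun p => f (stoppedChain T n (extendSkeleton n p.1 p.2.1),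
      ((p.1 ⟨n, Finset.mem_Iic.2 le_rfl⟩).2, p.2.1))) (by fun_prop)
  simp only [stoppedChain_extendSkeleton, Preorder.frestrictLe_apply, lintegral_const,
    measure_univ, mul_one] at e1
  rw [e1]
  have hg : Measurable fun p : (ℕ → E × ℝ≥0∞) × E × ℝ≥0∞ =>
      ∫⁻ y, f (p.1, (p.2.2, y)) ∂c.jumpKernel p.2.1 := by
    have := Measurable.lintegral_kernel_prod_right'
      (κ := c.jumpKernel.comap (fun p : (ℕ → E × ℝ≥0∞) × E × ℝ≥0∞ => p.2.1) (by fun_prop))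
      (f := fun q : ((ℕ → E × ℝ≥0∞) × E × ℝ≥0∞) × E => f (q.1.1, (q.1.2.2, q.2))) (by fun_prop)
    exact this
  have e2 := c.lintegral_stoppedChain_holding μ T n hg
  refine e2.trans (lintegral_congr fun ω => ?_)
  rw [clockKernel, Kernel.lintegral_prod _ _ _ (by fun_prop)]

/-- The truncated chain is a Markov chain with kernel `truncKernel`. -/
lemma map_stoppedChain_succ (c : JumpRates E) (μ : Measure E) [IsProbabilityMeasure μ]
    (T : ℝ≥0) (n : ℕ) :
    (c.skeletonLaw μ).map (fun ω => (stoppedChain T n ω, truncChain T ω (n + 1))) =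
      (c.skeletonLaw μ).map (stoppedChain T n) ⊗ₘ
        (c.truncKernel T).comap (fun w : ℕ → E × ℝ≥0∞ => w n) (measurable_pi_apply n) := by
  refine Measure.ext_of_lintegral _ fun f hf => ?_
  have hlast : ∀ ω : ℕ → E × ℝ≥0∞, stoppedChain T n ω n = truncChain T ω n := fun ω => by
    simp [stoppedChain]
  rw [lintegral_map hf (by fun_prop), Measure.lintegral_compProd hf,
    lintegral_map (Measurable.lintegral_kernel_prod_right' hf) (by fun_prop)]
  have e := c.lintegral_stoppedChain_clock μ T n
    (f := fun p => f (p.1, truncStep T (p.1 n) p.2)) (by fun_prop)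
  simp only [hlast] at e
  refine Eq.trans ?_ (e.trans (lintegral_congr fun ω => ?_))
  · exact lintegral_congr fun ω => by rw [truncChain]
  rw [Kernel.comap_apply, lintegral_truncKernel_eq_clockKernel _ _ _ (by fun_prop), hlast]
  rcases le_or_gt (jumpTime ω n) T with hn | hn
  · rw [truncChain_of_le hn]
  · -- Once the window has ended, the step no longer depends on the clock.
    have : ∀ q, truncStep T (truncChain T ω n) q = ((truncChain T ω n).1, ∞) := fun q =>
      truncStep_of_lt (by simp [truncChain_snd_of_lt hn])
    simp [this]

end JumpRates

/-! ### The truncated chain and the path on `[0, T]` determine each other -/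

section Paths

variable {E : Type*}

lemma stateAt_of_mem_Ico {ω : ℕ → E × ℝ≥0∞} {t : ℝ≥0} {n : ℕ} (h1 : jumpTime ω n ≤ t)
    (h2 : (t : ℝ≥0∞) < jumpTime ω (n + 1)) : stateAt ω t = Sum.inl (ω n).1 := by
  classical
  have h : ∃ n, jumpTime ω n ≤ t ∧ (t : ℝ≥0∞) < jumpTime ω (n + 1) := ⟨n, h1, h2⟩
  rw [stateAt, dif_pos h]
  obtain ⟨h3, h4⟩ := Nat.find_spec h
  have e : Nat.find h = n := by
    refine le_antisymm (Nat.find_min' h ⟨h1, h2⟩) ?_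
    by_contra! hlt
    exact absurd (((jumpTime_mono ω hlt).trans h1)) (not_le.2 h4)
  rw [e]

lemma stateAt_of_forall_notMem {ω : ℕ → E × ℝ≥0∞} {t : ℝ≥0}
    (h : ¬ ∃ n, jumpTime ω n ≤ t ∧ (t : ℝ≥0∞) < jumpTime ω (n + 1)) :
    stateAt ω t = Sum.inr () := by
  rw [stateAt, dif_neg h]

/-- The skeleton whose states are those of `w` and whose jump times are the times of `w`. -/
noncomputable def skeletonOf (w : ℕ → E × ℝ≥0∞) : ℕ → E × ℝ≥0∞ :=
  fun n => ((w n).1, (w (n + 1)).2 - (w n).2)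

lemma jumpTime_skeletonOf {w : ℕ → E × ℝ≥0∞} (h0 : (w 0).2 = 0)
    (hmono : ∀ n, (w n).2 ≤ (w (n + 1)).2) (n : ℕ) : jumpTime (skeletonOf w) n = (w n).2 := by
  induction n with
  | zero => simp [jumpTime, h0]
  | succ n ih =>
    rw [jumpTime_succ, ih]
    exact add_tsub_cancel_of_le (hmono n)

lemma truncChain_snd_le_succ (T : ℝ≥0) (ω : ℕ → E × ℝ≥0∞) (n : ℕ) :
    (truncChain T ω n).2 ≤ (truncChain T ω (n + 1)).2 := by
  rw [truncChain]
  rcases le_or_gt ((truncChain T ω n).2 + (ω n).2) T with h | h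
  · rw [truncStep_of_le (by exact h)]
    exact le_self_add
  · rw [truncStep_of_lt (by exact h)]
    exact le_top

/-- The path up to time `T` depends on the skeleton only through the truncated chain. -/
lemma stateAt_skeletonOf_truncChain {T t : ℝ≥0} (ht : t ≤ T) (ω : ℕ → E × ℝ≥0∞) :
    stateAt (skeletonOf (truncChain T ω)) t = stateAt ω t := by
  have hj : ∀ n, jumpTime (skeletonOf (truncChain T ω)) n = (truncChain T ω n).2 :=
    jumpTime_skeletonOf rfl (truncChain_snd_le_succ T ω)
  by_cases h : ∃ n, jumpTime ω n ≤ t ∧ (t : ℝ≥0∞) < jumpTime ω (n + 1)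
  · obtain ⟨n, hn⟩ := h
    have hn' := (truncChain_mem_Ico_iff ht n).2 hn
    rw [← hj, ← hj] at hn'
    rw [stateAt_of_mem_Ico hn.1 hn.2, stateAt_of_mem_Ico hn'.1 hn'.2]
    simp only [skeletonOf]
    rw [truncChain_of_le (hn.1.trans (by exact_mod_cast ht))]
  · rw [stateAt_of_forall_notMem h, stateAt_of_forall_notMem]
    rintro ⟨n, hn⟩
    rw [hj, hj, truncChain_mem_Ico_iff ht n] at hn
    exact h ⟨n, hn⟩

/-- The trajectories of the truncated chain that occur almost surely. -/
def truncTrajectories (E : Type*) (T : ℝ≥0) : Set (ℕ → E × ℝ≥0∞) :=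
  {w | (w 0).2 = 0 ∧ ∀ n, IsTruncTransition T (w n) (w (n + 1))}

lemma IsTruncTransition.snd_le {T : ℝ≥0} {z w : E × ℝ≥0∞} (h : IsTruncTransition T z w) :
    z.2 ≤ w.2 := by
  rcases h with ⟨h, -⟩ | ⟨h, -⟩
  · rw [h]; exact le_top
  · exact h.le

lemma IsTruncTransition.snd_lt {T : ℝ≥0} {z w : E × ℝ≥0∞} (h : IsTruncTransition T z w)
    (hz : z.2 ≠ ∞) : z.2 < w.2 := by
  rcases h with ⟨h, -⟩ | ⟨h, -⟩
  · rw [h]; exact hz.lt_top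
  · exact h

lemma stateAt_skeletonOf_of_mem {T t : ℝ≥0} {w : ℕ → E × ℝ≥0∞} (hw : w ∈ truncTrajectories E T)
    {n : ℕ} (h1 : (w n).2 ≤ t) (h2 : (t : ℝ≥0∞) < (w (n + 1)).2) :
    stateAt (skeletonOf w) t = Sum.inl (w n).1 := by
  have hj := jumpTime_skeletonOf hw.1 fun n => (hw.2 n).snd_le
  exact stateAt_of_mem_Ico (ω := skeletonOf w) (n := n) (by rwa [hj]) (by rwa [hj])

/-- Countably many times in `[0, T]`: the truncations of a dense sequence, and `T` itself. -/
noncomputable def observationTime (T : ℝ≥0) : Option ℕ → Set.Iic T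
  | some k => ⟨min (TopologicalSpace.denseSeq ℝ≥0 k) T, Set.mem_Iic.2 (min_le_right _ _)⟩
  | none => ⟨T, Set.self_mem_Iic⟩

lemma exists_observationTime_mem_Ico {T : ℝ≥0} {a b : ℝ≥0∞} (ha : a ≤ T) (hab : a < b) :
    ∃ i, a ≤ (observationTime T i : ℝ≥0) ∧ ((observationTime T i : ℝ≥0) : ℝ≥0∞) < b := by
  rcases ha.lt_or_eq with h | rfl
  · obtain ⟨a, rfl⟩ : ∃ a' : ℝ≥0, a = a' := ⟨a.toNNReal, (ENNReal.coe_toNNReal hab.ne_top).symm⟩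
    obtain ⟨b', hb1, hb2⟩ := ENNReal.lt_iff_exists_nnreal_btwn.1 (lt_min h hab)
    have hab' : a < b' := by exact_mod_cast hb1
    obtain ⟨_, ⟨k, rfl⟩, hk1, hk2⟩ :=
      (TopologicalSpace.denseRange_denseSeq ℝ≥0).exists_between hab'
    have hb' := lt_min_iff.1 hb2
    have hkT : TopologicalSpace.denseSeq ℝ≥0 k < T := hk2.trans (by exact_mod_cast hb'.1)
    have e : ((observationTime T (some k) : Set.Iic T) : ℝ≥0) = TopologicalSpace.denseSeq ℝ≥0 k :=
      (show min _ T = _ from min_eq_left hkT.le)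
    refine ⟨some k, ?_, ?_⟩
    · rw [e]; exact_mod_cast hk1.le
    · rw [e]
      refine lt_trans ?_ hb'.2
      exact_mod_cast hk2
  · exact ⟨none, by simp [observationTime], by simpa [observationTime] using hab⟩

/-- If two trajectories agree at step `n` and have the same path at the observation times, the next
jump of the second one cannot come later than that of the first one. -/
lemma snd_succ_le_of_stateAt_eq {T : ℝ≥0} {w w' : ℕ → E × ℝ≥0∞} (hw : w ∈ truncTrajectories E T)
    (hw' : w' ∈ truncTrajectories E T)
    (h : ∀ i, stateAt (skeletonOf w) (observationTime T i) =
      stateAt (skeletonOf w') (observationTime T i))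
    {n : ℕ} (hn : w n = w' n) : (w' (n + 1)).2 ≤ (w (n + 1)).2 := by
  by_contra! hlt
  rcases hw.2 n with ⟨h1, -⟩ | ⟨h1, h2, h3⟩
  · rw [h1] at hlt
    exact not_top_lt hlt
  -- Just after the earlier jump, `w` has left the state in which `w'` still is.
  have hne : (w (n + 1)).2 ≠ ∞ := ne_top_of_le_ne_top ENNReal.coe_ne_top h2
  obtain ⟨i, hi1, hi2⟩ := exists_observationTime_mem_Ico h2
    (lt_min ((hw.2 (n + 1)).snd_lt hne) hlt)
  have hi2' := lt_min_iff.1 hi2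
  have := h i
  rw [stateAt_skeletonOf_of_mem hw hi1 hi2'.1,
    stateAt_skeletonOf_of_mem hw' (n := n) (hn ▸ h1.le.trans hi1) hi2'.2, ← hn] at this
  exact h3 (Sum.inl_injective this)

lemma injOn_stateAt_observationTime (T : ℝ≥0) :
    Set.InjOn (fun (w : ℕ → E × ℝ≥0∞) i => stateAt (skeletonOf w) (observationTime T i))
      (truncTrajectories E T) := by
  intro w hw w' hw' heq
  have h : ∀ i, stateAt (skeletonOf w) (observationTime T i) =
    stateAt (skeletonOf w') (observationTime T i) := fun i => congrFun heq i
  funext n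
  induction n with
  | zero =>
    refine Prod.ext ?_ (hw.1.trans hw'.1.symm)
    have hpos : ∀ v ∈ truncTrajectories E T, (0 : ℝ≥0∞) < (v 1).2 := fun v hv => by
      rw [← hv.1]
      exact (hv.2 0).snd_lt (by simp [hv.1])
    obtain ⟨i, -, hi2⟩ := exists_observationTime_mem_Ico (T := T) zero_le
      (lt_min (hpos w hw) (hpos w' hw'))
    have hi2' := lt_min_iff.1 hi2
    have := h i
    rw [stateAt_skeletonOf_of_mem hw (n := 0) (by simp [hw.1]) hi2'.1,
      stateAt_skeletonOf_of_mem hw' (n := 0) (by simp [hw'.1]) hi2'.2] at this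
    exact Sum.inl_injective this
  | succ n ih =>
    have hsnd : (w (n + 1)).2 = (w' (n + 1)).2 :=
      le_antisymm (snd_succ_le_of_stateAt_eq hw' hw (fun i => (h i).symm) ih.symm)
        (snd_succ_le_of_stateAt_eq hw hw' h ih)
    refine Prod.ext ?_ hsnd
    rcases hw.2 n with ⟨h1, h2⟩ | ⟨h1, h2, h3⟩
    · rcases hw'.2 n with ⟨h1', h2'⟩ | ⟨h1', h2', h3'⟩
      · rw [h2, h2', ih]
      · rw [← hsnd, h1] at h2'
        simp at h2'
    · have hne : (w (n + 1)).2 ≠ ∞ := ne_top_of_le_ne_top ENNReal.coe_ne_top h2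
      obtain ⟨i, hi1, hi2⟩ := exists_observationTime_mem_Ico h2
        (lt_min ((hw.2 (n + 1)).snd_lt hne) (hsnd ▸ (hw'.2 (n + 1)).snd_lt (hsnd ▸ hne)))
      have hi2' := lt_min_iff.1 hi2
      have := h i
      rw [stateAt_skeletonOf_of_mem hw hi1 hi2'.1,
        stateAt_skeletonOf_of_mem hw' (hsnd ▸ hi1) hi2'.2] at this
      exact Sum.inl_injective this

variable [MeasurableSpace E]

lemma measurable_skeletonOf : Measurable (skeletonOf (E := E)) := by
  unfold skeletonOf; fun_prop

lemma measurable_stateAt_skeletonOf (t : ℝ≥0) :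
    Measurable fun w : ℕ → E × ℝ≥0∞ => stateAt (skeletonOf w) t :=
  (measurable_stateAt t).comp measurable_skeletonOf

lemma measurable_truncChain_pi (T : ℝ≥0) : Measurable (truncChain (E := E) T) :=
  measurable_pi_lambda _ (measurable_truncChain T)

variable [DiscreteMeasurableSpace E] [Countable E]

lemma measurableSet_truncTrajectories (T : ℝ≥0) : MeasurableSet (truncTrajectories E T) := by
  have h : truncTrajectories E T = {w | (w 0).2 = 0} ∩
      ⋂ n, (fun w : ℕ → E × ℝ≥0∞ => (w n, w (n + 1))) ⁻¹'
        {p | IsTruncTransition T p.1 p.2} := by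
    ext w
    simp [truncTrajectories]
  rw [h]
  refine (measurableSet_eq_fun (measurable_snd.comp (measurable_pi_apply 0))
    measurable_const).inter (MeasurableSet.iInter fun n => ?_)
  exact (measurableSet_isTruncTransition T).preimage (by fun_prop)

namespace JumpRates

lemma ae_truncChain_mem_truncTrajectories (c : JumpRates E) (μ : Measure E)
    [IsProbabilityMeasure μ] (T : ℝ≥0) :
    ∀ᵐ ω ∂c.skeletonLaw μ, truncChain T ω ∈ truncTrajectories E T := by
  have h : ∀ n, ∀ᵐ ω ∂c.skeletonLaw μ,
      IsTruncTransition T (truncChain T ω n) (truncChain T ω (n + 1)) := fun n => by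
    have hm : MeasurableSet {p : (ℕ → E × ℝ≥0∞) × (E × ℝ≥0∞) | IsTruncTransition T (p.1 n) p.2} :=
      (measurableSet_isTruncTransition T).preimage
        (f := fun p : (ℕ → E × ℝ≥0∞) × (E × ℝ≥0∞) => (p.1 n, p.2)) (by fun_prop)
    have h1 : ∀ᵐ p ∂(c.skeletonLaw μ).map
        (fun ω => (stoppedChain T n ω, truncChain T ω (n + 1))),
        IsTruncTransition T (p.1 n) p.2 := by
      rw [map_stoppedChain_succ, Measure.ae_compProd_iff hm]
      exact ae_of_all _ fun w => ae_isTruncTransition c T (w n)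
    rw [ae_map_iff (by fun_prop) hm] at h1
    filter_upwards [h1] with ω hω
    simpa [stoppedChain] using hω
  filter_upwards [ae_all_iff.2 h] with ω hω using ⟨rfl, hω⟩

/-- The path measure and the law of the truncated chain carry the same relative entropy. -/
lemma klDiv_pathLaw (c c' : JumpRates E) (μ ν : Measure E) [IsProbabilityMeasure μ]
    [IsProbabilityMeasure ν] (T : ℝ≥0) :
    klDiv (c.pathLaw μ T) (c'.pathLaw ν T) =
      klDiv ((c.skeletonLaw μ).map (truncChain T)) ((c'.skeletonLaw ν).map (truncChain T)) := by
  have hpath : Measurable fun (w : ℕ → E × ℝ≥0∞) (t : Set.Iic T) => stateAt (skeletonOf w) t :=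
    measurable_pi_lambda _ fun t => measurable_stateAt_skeletonOf t
  have hW := measurable_truncChain_pi (E := E) T
  have hlaw : ∀ (d : JumpRates E) (ρ : Measure E), d.pathLaw ρ T =
      ((d.skeletonLaw ρ).map (truncChain T)).map
        fun w (t : Set.Iic T) => stateAt (skeletonOf w) t := by
    intro d ρ
    rw [Measure.map_map hpath hW, pathLaw]
    congr 1
    funext ω t
    exact (stateAt_skeletonOf_truncChain t.2 ω).symm
  have : ∀ (d : JumpRates E) (ρ : Measure E) [IsProbabilityMeasure ρ],
      IsProbabilityMeasure ((d.skeletonLaw ρ).map (truncChain T)) := fun d ρ _ =>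
    Measure.isProbabilityMeasure_map hW.aemeasurable
  rw [hlaw, hlaw]
  refine le_antisymm (klDiv_map_le _ _ hpath) ?_
  have : ∀ (d : JumpRates E) (ρ : Measure E) [IsProbabilityMeasure ρ], IsProbabilityMeasure
      (((d.skeletonLaw ρ).map (truncChain T)).map
        fun w (t : Set.Iic T) => stateAt (skeletonOf w) t) := fun d ρ _ =>
    Measure.isProbabilityMeasure_map hpath.aemeasurable
  have : DiscreteMeasurableSpace (E ⊕ Unit) :=
    ⟨fun s => measurableSet_sum_iff.2 ⟨.of_discrete, .of_discrete⟩⟩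
  have : StandardBorelSpace (Option ℕ → E ⊕ Unit) := inferInstance
  have hobs : Measurable fun (w : ℕ → E × ℝ≥0∞) i =>
      stateAt (skeletonOf w) (observationTime T i) :=
    measurable_pi_lambda _ fun i => measurable_stateAt_skeletonOf _
  have hG : ∀ (d : JumpRates E) (ρ : Measure E) [IsProbabilityMeasure ρ],
      ∀ᵐ w ∂(d.skeletonLaw ρ).map (truncChain T), w ∈ truncTrajectories E T := fun d ρ _ =>
    (ae_map_iff hW.aemeasurable (measurableSet_truncTrajectories T)).2
      (ae_truncChain_mem_truncTrajectories d ρ T)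
  rw [← klDiv_map_of_injOn hobs (measurableSet_truncTrajectories T)
    (injOn_stateAt_observationTime T) (hG c μ) (hG c' ν)]
  have hr : Measurable fun (x : Set.Iic T → E ⊕ Unit) i => x (observationTime T i) := by fun_prop
  have hcomp : ∀ ρ : Measure (ℕ → E × ℝ≥0∞),
      ρ.map (fun w i => stateAt (skeletonOf w) (observationTime T i)) =
        (ρ.map fun w (t : Set.Iic T) => stateAt (skeletonOf w) t).map
          fun x i => x (observationTime T i) := fun ρ => by
    rw [Measure.map_map hr hpath]
    rfl
  rw [hcomp, hcomp]
  exact klDiv_map_le _ _ hr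

end JumpRates

end Paths

/-! ### Relative entropy of the truncated chain -/

namespace JumpRates

variable {E : Type*} [MeasurableSpace E] [DiscreteMeasurableSpace E] [Countable E]

lemma klDiv_stoppedChain_zero (c c' : JumpRates E) (μ ν : Measure E) [IsProbabilityMeasure μ]
    [IsProbabilityMeasure ν] (T : ℝ≥0) :
    klDiv ((c.skeletonLaw μ).map (stoppedChain T 0)) ((c'.skeletonLaw ν).map (stoppedChain T 0)) =
      klDiv μ ν := by
  have hg : Measurable fun (x : E) (_ : ℕ) => (x, (0 : ℝ≥0∞)) := by fun_prop
  have h : ∀ (d : JumpRates E) (ρ : Measure E) [IsProbabilityMeasure ρ],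
      (d.skeletonLaw ρ).map (stoppedChain T 0) = ρ.map fun x (_ : ℕ) => (x, (0 : ℝ≥0∞)) := by
    intro d ρ _
    have e : stoppedChain (E := E) T 0 =
        (fun x (_ : ℕ) => (x, (0 : ℝ≥0∞))) ∘ Prod.fst ∘ fun ω => ω 0 := by
      funext ω i
      simp [stoppedChain, truncChain]
    have e2 : ρ.map (fun x (_ : ℕ) => (x, (0 : ℝ≥0∞))) =
        ((ρ ⊗ₘ d.holdingKernel).map Prod.fst).map fun x (_ : ℕ) => (x, (0 : ℝ≥0∞)) := by
      rw [← Measure.fst, Measure.fst_compProd]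
    rw [e, e2, ← map_zero_skeletonLaw, Measure.map_map measurable_fst (by fun_prop),
      Measure.map_map hg (by fun_prop)]
  rw [h, h]
  exact klDiv_map_of_leftInverse hg (k := fun w => (w 0).1) (by fun_prop) (ae_of_all _ fun _ => rfl)
    (ae_of_all _ fun _ => rfl)

lemma klDiv_stoppedChain_pair (c c' : JumpRates E) (μ ν : Measure E) [IsProbabilityMeasure μ]
    [IsProbabilityMeasure ν] (T : ℝ≥0) (hc : ∀ x y, c'.rate x y = 0 → c.rate x y = 0) (n : ℕ) :
    klDiv ((c.skeletonLaw μ).map fun ω => (stoppedChain T n ω, truncChain T ω (n + 1)))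
        ((c'.skeletonLaw ν).map fun ω => (stoppedChain T n ω, truncChain T ω (n + 1))) =
      klDiv ((c.skeletonLaw μ).map (stoppedChain T n)) ((c'.skeletonLaw ν).map (stoppedChain T n)) +
      ∫⁻ ω, entropyRateAt c c' (truncChain T ω n).1 *
        meanOccupation (c.total (truncChain T ω n).1) (timeLeft T (truncChain T ω n).2)
          ∂c.skeletonLaw μ := by
  have hprob : ∀ (d : JumpRates E) (ρ : Measure E) [IsProbabilityMeasure ρ] (m : ℕ),
      IsProbabilityMeasure ((d.skeletonLaw ρ).map (stoppedChain T m)) := fun d ρ _ m =>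
    Measure.isProbabilityMeasure_map (by fun_prop)
  have hdens : Measurable (Function.uncurry fun (w : ℕ → E × ℝ≥0∞) z =>
      stepDensity c c' T (w n) z) :=
    (measurable_stepDensity c c' T).comp
      (f := fun p : (ℕ → E × ℝ≥0∞) × (E × ℝ≥0∞) => (p.1 n, p.2)) (by fun_prop)
  rw [map_stoppedChain_succ, map_stoppedChain_succ, klDiv_compProd_of_density hdens
    fun w => truncKernel_eq_withDensity c c' T hc (w n)]
  congr 1
  simp only [Kernel.comap_apply, lintegral_klFun_stepDensity c c' T hc]
  have hm : Measurable fun z : E × ℝ≥0∞ => entropyRateAt c c' z.1 *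
      meanOccupation (c.total z.1) (timeLeft T z.2) :=
    measurable_from_prod_countable_right fun x =>
      ((measurable_meanOccupation (c.total x)).comp (measurable_timeLeft T)).const_mul
        (entropyRateAt c c' x)
  have hm' : Measurable fun w : ℕ → E × ℝ≥0∞ => entropyRateAt c c' (w n).1 *
      meanOccupation (c.total (w n).1) (timeLeft T (w n).2) := hm.comp (measurable_pi_apply n)
  rw [lintegral_map hm' (by fun_prop)]
  simp [stoppedChain]

lemma klDiv_stoppedChain_succ (c c' : JumpRates E) (μ ν : Measure E) [IsProbabilityMeasure μ]
    [IsProbabilityMeasure ν] (T : ℝ≥0) (hc : ∀ x y, c'.rate x y = 0 → c.rate x y = 0) (n : ℕ) :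
    klDiv ((c.skeletonLaw μ).map (stoppedChain T (n + 1)))
        ((c'.skeletonLaw ν).map (stoppedChain T (n + 1))) =
      klDiv ((c.skeletonLaw μ).map (stoppedChain T n)) ((c'.skeletonLaw ν).map (stoppedChain T n)) +
      ∫⁻ ω, entropyRateAt c c' (truncChain T ω n).1 *
        meanOccupation (c.total (truncChain T ω n).1) (timeLeft T (truncChain T ω n).2)
          ∂c.skeletonLaw μ := by
  have hprob : ∀ (d : JumpRates E) (ρ : Measure E) [IsProbabilityMeasure ρ] (m : ℕ),
      IsProbabilityMeasure ((d.skeletonLaw ρ).map (stoppedChain T m)) := fun d ρ _ m =>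
    Measure.isProbabilityMeasure_map (by fun_prop)
  -- The chain stopped at `n + 1` and the pair of the chain stopped at `n` and the next position are
  -- functions of each other.
  set pair : (ℕ → E × ℝ≥0∞) → (ℕ → E × ℝ≥0∞) × (E × ℝ≥0∞) :=
    fun ω => (stoppedChain T n ω, truncChain T ω (n + 1)) with hpair
  have hpm : Measurable pair := by fun_prop
  have hpprob : ∀ (d : JumpRates E) (ρ : Measure E) [IsProbabilityMeasure ρ],
      IsProbabilityMeasure ((d.skeletonLaw ρ).map pair) := fun d ρ _ =>
    Measure.isProbabilityMeasure_map hpm.aemeasurable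
  have hk : Measurable fun w : ℕ → E × ℝ≥0∞ => ((fun i => w (min i n)), w (n + 1)) := by fun_prop
  have hg : Measurable fun (p : (ℕ → E × ℝ≥0∞) × (E × ℝ≥0∞)) i =>
      if i ≤ n then p.1 i else p.2 := by
    refine measurable_pi_lambda _ fun i => ?_
    split_ifs <;> fun_prop
  have e1 : ∀ P : Measure (ℕ → E × ℝ≥0∞), P.map pair =
      (P.map (stoppedChain T (n + 1))).map fun w => ((fun i => w (min i n)), w (n + 1)) := by
    intro P
    rw [Measure.map_map hk (by fun_prop)]
    congr 1
    funext ω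
    refine Prod.ext (funext fun i => ?_) ?_ <;> simp [hpair, stoppedChain]
  have e2 : ∀ P : Measure (ℕ → E × ℝ≥0∞), P.map (stoppedChain T (n + 1)) =
      (P.map pair).map fun p i => if i ≤ n then p.1 i else p.2 := by
    intro P
    rw [Measure.map_map hg hpm]
    congr 1
    funext ω i
    by_cases hi : i ≤ n
    · simp [hpair, stoppedChain, hi, hi.trans n.le_succ]
    · simp [hpair, stoppedChain, hi, not_le.1 hi]
  have e3 : klDiv ((c.skeletonLaw μ).map (stoppedChain T (n + 1)))
      ((c'.skeletonLaw ν).map (stoppedChain T (n + 1))) =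
      klDiv ((c.skeletonLaw μ).map pair) ((c'.skeletonLaw ν).map pair) := by
    refine le_antisymm ?_ ?_
    · rw [e2, e2]
      exact klDiv_map_le _ _ hg
    · rw [e1, e1]
      exact klDiv_map_le _ _ hk
  rw [e3, klDiv_stoppedChain_pair c c' μ ν T hc]

/-- Without explosion, the relative entropy of the truncated chain is the sum of the entropies of
its initial law and of its steps. -/
lemma klDiv_truncChain (c c' : JumpRates E) (μ ν : Measure E) [IsProbabilityMeasure μ]
    [IsProbabilityMeasure ν] (T : ℝ≥0) (hc : ∀ x y, c'.rate x y = 0 → c.rate x y = 0)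
    (hμ : ∀ᵐ ω ∂c.skeletonLaw μ, ∃ n, (truncChain T ω n).2 = ∞)
    (hν : ∀ᵐ ω ∂c'.skeletonLaw ν, ∃ n, (truncChain T ω n).2 = ∞) :
    klDiv ((c.skeletonLaw μ).map (truncChain T)) ((c'.skeletonLaw ν).map (truncChain T)) =
      klDiv μ ν + ∑' n, ∫⁻ ω, entropyRateAt c c' (truncChain T ω n).1 *
        meanOccupation (c.total (truncChain T ω n).1) (timeLeft T (truncChain T ω n).2)
          ∂c.skeletonLaw μ := by
  have hW := measurable_truncChain_pi (E := E) T
  have hprob : ∀ (d : JumpRates E) (ρ : Measure E) [IsProbabilityMeasure ρ],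
      IsProbabilityMeasure ((d.skeletonLaw ρ).map (truncChain T)) := fun d ρ _ =>
    Measure.isProbabilityMeasure_map hW.aemeasurable
  have hstep : ∀ n, klDiv ((c.skeletonLaw μ).map (stoppedChain T n))
      ((c'.skeletonLaw ν).map (stoppedChain T n)) = klDiv μ ν + ∑ i ∈ Finset.range n,
        ∫⁻ ω, entropyRateAt c c' (truncChain T ω i).1 *
          meanOccupation (c.total (truncChain T ω i).1) (timeLeft T (truncChain T ω i).2)
            ∂c.skeletonLaw μ := by
    intro n
    induction n with
    | zero => rw [klDiv_stoppedChain_zero, Finset.sum_range_zero, add_zero]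
    | succ n ih => rw [klDiv_stoppedChain_succ c c' μ ν T hc, ih, Finset.sum_range_succ, add_assoc]
  rw [ENNReal.tsum_eq_iSup_nat, ENNReal.add_iSup]
  simp only [← hstep]
  have hfreeze : ∀ n ω, (truncChain T ω n).2 = ∞ →
      stoppedChain (E := E) T n ω = truncChain T ω := by
    intro n ω h
    funext i
    rcases le_total i n with hi | hi
    · simp [stoppedChain, hi]
    · simp [stoppedChain, hi, truncChain_of_snd_eq_top h hi]
  have hD : ∀ n, MeasurableSet {w : ℕ → E × ℝ≥0∞ | ∀ m ≥ n, (w m).2 = ∞} := fun n => by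
    have e : {w : ℕ → E × ℝ≥0∞ | ∀ m ≥ n, (w m).2 = ∞} =
        ⋂ m, ⋂ (_ : n ≤ m), {w | (w m).2 = ∞} := by
      ext w
      simp
    rw [e]
    exact MeasurableSet.iInter fun m => MeasurableSet.iInter fun _ =>
      measurableSet_eq_fun (measurable_snd.comp (measurable_pi_apply m)) measurable_const
  refine le_antisymm ?_ (iSup_le fun n => ?_)
  · refine klDiv_map_le_of_exhaustion hW (measurable_stoppedChain T) hD
      (fun n m hnm w hw k hk => hw k (hnm.trans hk)) (fun n ω h => hfreeze n ω (h n le_rfl))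
      (fun n ω h => hfreeze n ω ?_) ?_ ?_
    · simpa [stoppedChain] using h n le_rfl
    · filter_upwards [hμ] with ω ⟨n, hn⟩
      exact ⟨n, fun m hm => by rw [truncChain_of_snd_eq_top hn hm, hn]⟩
    · filter_upwards [hν] with ω ⟨n, hn⟩
      exact ⟨n, fun m hm => by rw [truncChain_of_snd_eq_top hn hm, hn]⟩
  · have hk : Measurable fun (w : ℕ → E × ℝ≥0∞) i => w (min i n) := by fun_prop
    have e : ∀ P : Measure (ℕ → E × ℝ≥0∞), P.map (stoppedChain T n) =
        (P.map (truncChain T)).map fun w i => w (min i n) := fun P => by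
      rw [Measure.map_map hk hW]
      rfl
    rw [e, e]
    exact klDiv_map_le _ _ hk

/-! ### Stationarity: absence of explosion and occupation times -/

lemma ae_exists_truncChain_snd_eq_top (c : JumpRates E) (μ : Measure E) (hμ : c.IsStationary μ)
    (T : ℝ≥0) : ∀ᵐ ω ∂c.skeletonLaw μ, ∃ n, (truncChain T ω n).2 = ∞ := by
  have hm : MeasurableSet {x : E ⊕ Unit | x ≠ Sum.inr ()} :=
    measurableSet_sum_iff.2 ⟨.of_discrete, .of_discrete⟩
  have h : ∀ᵐ x ∂(c.skeletonLaw μ).map (fun ω => stateAt ω T), x ≠ Sum.inr () := by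
    rw [hμ T, ae_map_iff measurable_inl.aemeasurable hm]
    exact ae_of_all _ fun x => Sum.inl_ne_inr
  rw [ae_map_iff (measurable_stateAt T).aemeasurable hm] at h
  filter_upwards [h] with ω hω
  by_contra! hne
  refine hω (stateAt_of_forall_notMem ?_)
  rintro ⟨n, -, hn⟩
  exact hne (n + 1) (truncChain_snd_of_lt hn)

/-- In the stationary chain, `f` has mean `∫ f dμ` at time `t`; the mean is split according to the
number of jumps before `t`. -/
lemma tsum_lintegral_survival (c : JumpRates E) (μ : Measure E) [IsProbabilityMeasure μ]
    (hμ : c.IsStationary μ) {T t : ℝ≥0} (ht : t ≤ T) (f : E → ℝ≥0∞) :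
    ∑' n, ∫⁻ ω, f (truncChain T ω n).1 *
      survival (c.total (truncChain T ω n).1) (truncChain T ω n).2 t
      ∂c.skeletonLaw μ = ∫⁻ x, f x ∂μ := by
  classical
  have hf : Measurable f := measurable_of_countable f
  have hF : Measurable (Sum.elim f fun _ : Unit => (0 : ℝ≥0∞)) :=
    hf.sumElim measurable_const
  have h1 : ∫⁻ x, f x ∂μ =
      ∫⁻ ω, Sum.elim f (fun _ => 0) (stateAt ω t) ∂c.skeletonLaw μ := by
    rw [← lintegral_map hF (measurable_stateAt t), hμ t, lintegral_map hF measurable_inl]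
    rfl
  -- the term of the state in which the path is at time `t`
  let g : ℕ → (ℕ → E × ℝ≥0∞) × (E × ℝ≥0∞) → ℝ≥0∞ := fun n p =>
    f (p.1 n).1 * ((if (p.1 n).2 ≤ t then 1 else 0) * (if (t : ℝ≥0∞) < p.2.2 then 1 else 0))
  have hg : ∀ n, Measurable (g n) := fun n => by
    refine (hf.comp (by fun_prop)).mul (Measurable.mul ?_ ?_)
    · exact Measurable.ite (measurableSet_le
        (measurable_snd.comp ((measurable_pi_apply n).comp measurable_fst)) measurable_const)
        measurable_const measurable_const
    · exact Measurable.ite (measurableSet_lt measurable_const (measurable_snd.comp measurable_snd))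
        measurable_const measurable_const
  have hlast : ∀ n (ω : ℕ → E × ℝ≥0∞), stoppedChain T n ω n = truncChain T ω n := fun n ω => by
    simp [stoppedChain]
  have h2 : ∀ ω : ℕ → E × ℝ≥0∞, Sum.elim f (fun _ => 0) (stateAt ω t) =
      ∑' n, g n (stoppedChain T n ω, truncChain T ω (n + 1)) := by
    intro ω
    have hzero : ∀ n, ¬ (jumpTime ω n ≤ t ∧ (t : ℝ≥0∞) < jumpTime ω (n + 1)) →
        g n (stoppedChain T n ω, truncChain T ω (n + 1)) = 0 := fun n hn => by
      rw [← truncChain_mem_Ico_iff ht n, not_and_or] at hn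
      rcases hn with hn | hn <;> simp [g, hlast, hn]
    by_cases h : ∃ n, jumpTime ω n ≤ t ∧ (t : ℝ≥0∞) < jumpTime ω (n + 1)
    · obtain ⟨n, hn⟩ := h
      rw [stateAt_of_mem_Ico hn.1 hn.2, tsum_eq_single n fun m hm => hzero m fun hm' => hm ?_]
      · obtain ⟨h3, h4⟩ := (truncChain_mem_Ico_iff ht n).2 hn
        have htT : (t : ℝ≥0∞) ≤ T := by exact_mod_cast ht
        simp only [g, hlast, h3, h4, if_true, mul_one, Sum.elim_inl]
        rw [truncChain_of_le (hn.1.trans htT)]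
      · by_contra hne
        rcases lt_or_gt_of_ne hne with hlt | hlt
        · exact absurd ((jumpTime_mono ω hlt).trans hn.1) (not_le.2 hm'.2)
        · exact absurd ((jumpTime_mono ω hlt).trans hm'.1) (not_le.2 hn.2)
    · rw [stateAt_of_forall_notMem h, Sum.elim_inr]
      exact (ENNReal.tsum_eq_zero.2 fun n => hzero n fun hn => h ⟨n, hn⟩).symm
  have hg' : ∀ n, AEMeasurable (fun ω => g n (stoppedChain T n ω, truncChain T ω (n + 1)))
      (c.skeletonLaw μ) := fun n => ((hg n).comp
    (f := fun ω => (stoppedChain T n ω, truncChain T ω (n + 1))) (by fun_prop)).aemeasurable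
  rw [h1, lintegral_congr h2, lintegral_tsum hg']
  refine tsum_congr fun n => ?_
  have h3 : ∫⁻ ω, g n (stoppedChain T n ω, truncChain T ω (n + 1)) ∂c.skeletonLaw μ =
      ∫⁻ p, g n p ∂(c.skeletonLaw μ).map
        (fun ω => (stoppedChain T n ω, truncChain T ω (n + 1))) := by
    rw [lintegral_map (hg n) (by fun_prop)]
  rw [h3, map_stoppedChain_succ, Measure.lintegral_compProd (hg n),
    lintegral_map (Measurable.lintegral_kernel_prod_right' (hg n)) (by fun_prop)]
  refine lintegral_congr fun ω => ?_
  have hm : MeasurableSet {w : E × ℝ≥0∞ | (t : ℝ≥0∞) < w.2} :=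
    measurableSet_lt measurable_const measurable_snd
  simp only [g, Kernel.comap_apply, hlast]
  rw [lintegral_const_mul _ (by
    exact measurable_const.mul (Measurable.ite hm measurable_const measurable_const))]
  congr 1
  by_cases hs : (truncChain T ω n).2 ≤ t
  · rw [if_pos hs, ← truncKernel_survival c ht hs]
    simp only [one_mul]
    rw [← lintegral_indicator_one hm]
    exact lintegral_congr fun w => by simp [Set.indicator]
  · rw [survival_of_lt _ (not_le.1 hs), if_neg hs]
    simp

/-- The expected time in `[0, T]` weighted by `f` of the stationary chain, summed over the visited
states, is `T ∫ f dμ`. -/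
lemma tsum_lintegral_meanOccupation (c : JumpRates E) (μ : Measure E) [IsProbabilityMeasure μ]
    (hμ : c.IsStationary μ) (T : ℝ≥0) (f : E → ℝ≥0∞) :
    ∑' n, ∫⁻ ω, f (truncChain T ω n).1 *
      meanOccupation (c.total (truncChain T ω n).1) (timeLeft T (truncChain T ω n).2)
        ∂c.skeletonLaw μ = T * ∫⁻ x, f x ∂μ := by
  have hf : Measurable f := measurable_of_countable f
  have hl : Measurable c.total := measurable_of_countable _
  let g : ℕ → ℝ → (ℕ → E × ℝ≥0∞) → ℝ≥0∞ := fun n t ω => f (truncChain T ω n).1 *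
    survival (c.total (truncChain T ω n).1) (truncChain T ω n).2 (ENNReal.ofReal t)
  have hg : ∀ n, Measurable (Function.uncurry (g n)) := fun n => by
    refine (hf.comp (f := fun p : ℝ × (ℕ → E × ℝ≥0∞) => (truncChain T p.2 n).1)
      (by fun_prop)).mul (measurable_survival.comp (f := fun p : ℝ × (ℕ → E × ℝ≥0∞) =>
        (c.total (truncChain T p.2 n).1, (truncChain T p.2 n).2, ENNReal.ofReal p.1))
          (by fun_prop))
  calc _ = ∑' n, ∫⁻ ω, (∫⁻ t in Set.Ioc 0 (T : ℝ), g n t ω) ∂c.skeletonLaw μ := by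
        refine tsum_congr fun n => lintegral_congr fun ω => ?_
        rw [lintegral_const_mul, lintegral_survival]
        exact measurable_survival.comp (f := fun t : ℝ =>
          (c.total (truncChain T ω n).1, (truncChain T ω n).2, ENNReal.ofReal t)) (by fun_prop)
    _ = ∑' n, ∫⁻ t in Set.Ioc 0 (T : ℝ), (∫⁻ ω, g n t ω ∂c.skeletonLaw μ) := by
        refine tsum_congr fun n => ?_
        rw [lintegral_lintegral_swap (hg n).aemeasurable]
    _ = ∫⁻ t in Set.Ioc 0 (T : ℝ), (∑' n, ∫⁻ ω, g n t ω ∂c.skeletonLaw μ) := by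
        rw [lintegral_tsum fun n => (hg n).lintegral_prod_right.aemeasurable]
    _ = ∫⁻ _ in Set.Ioc 0 (T : ℝ), ∫⁻ x, f x ∂μ := by
        refine setLIntegral_congr_fun measurableSet_Ioc fun t ht => ?_
        exact tsum_lintegral_survival c μ hμ (Real.toNNReal_le_iff_le_coe.2 ht.2) f
    _ = T * ∫⁻ x, f x ∂μ := by
        rw [setLIntegral_const, Real.volume_Ioc, sub_zero, ENNReal.ofReal_coe_nnreal, mul_comm]

end JumpRates

/-! ### The entropy rate as an integral of nonnegative terms -/

section Rate

variable {E : Type*} [MeasurableSpace E] [DiscreteMeasurableSpace E] [Countable E]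

lemma eintegral_count_rate_mul_log (c c' : JumpRates E)
    (hc : ∀ x y, c'.rate x y = 0 → c.rate x y = 0) (x : E) :
    eintegral Measure.count
        (fun y => ((c.rate x y * Real.log (c.rate x y / c'.rate x y) : ℝ) : EReal))
      - ((c.total x - c'.total x : ℝ) : EReal) = (c.entropyRateAt c' x : EReal) := by
  have hpt : ∀ y, ENNReal.ofReal (c.rate x y * Real.log (c.rate x y / c'.rate x y)) +
      ENNReal.ofReal (c'.rate x y) =
      ENNReal.ofReal (c'.rate x y * klFun (c.rate x y / c'.rate x y)) +
      ENNReal.ofReal (-(c.rate x y * Real.log (c.rate x y / c'.rate x y))) +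
      ENNReal.ofReal (c.rate x y) := by
    intro y
    have ha := c.rate_nonneg x y
    have ha' := c'.rate_nonneg x y
    have hk : 0 ≤ c'.rate x y * klFun (c.rate x y / c'.rate x y) :=
      mul_nonneg ha' (klFun_nonneg (div_nonneg ha ha'))
    have e : c'.rate x y * klFun (c.rate x y / c'.rate x y) =
        c.rate x y * Real.log (c.rate x y / c'.rate x y) + c'.rate x y - c.rate x y := by
      by_cases h : c'.rate x y = 0
      · simp [h, hc x y h]
      · rw [klFun]
        field_simp
    rcases le_total 0 (c.rate x y * Real.log (c.rate x y / c'.rate x y)) with h | h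
    · rw [ENNReal.ofReal_of_nonpos (neg_nonpos.2 h), add_zero, ← ENNReal.ofReal_add h ha',
        ← ENNReal.ofReal_add hk ha, e]
      congr 1; ring
    · rw [ENNReal.ofReal_of_nonpos h, zero_add, ← ENNReal.ofReal_add hk (neg_nonneg.2 h),
        ← ENNReal.ofReal_add (add_nonneg hk (neg_nonneg.2 h)) ha, e]
      congr 1; ring
  have hsum := tsum_congr (L := .unconditional E) hpt
  rw [ENNReal.tsum_add, ENNReal.tsum_add, ENNReal.tsum_add, ← c.ofReal_total, ← c'.ofReal_total]
    at hsum
  have hn : ∑' y, ENNReal.ofReal (-(c.rate x y * Real.log (c.rate x y / c'.rate x y))) ≠ ∞ := by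
    have hle : ∑' y, ENNReal.ofReal (-(c.rate x y * Real.log (c.rate x y / c'.rate x y))) ≤
        ENNReal.ofReal (c'.total x) := by
      rw [c'.ofReal_total]
      refine ENNReal.tsum_le_tsum fun y => ?_
      rcases le_total 0 (c.rate x y * Real.log (c.rate x y / c'.rate x y)) with h | h
      · rw [ENNReal.ofReal_of_nonpos (neg_nonpos.2 h)]
        exact zero_le
      · have := hpt y
        rw [ENNReal.ofReal_of_nonpos h, zero_add] at this
        rw [this, add_right_comm]
        exact le_add_self
    exact ne_top_of_le_ne_top ENNReal.ofReal_ne_top hle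
  rw [eintegral, lintegral_count, lintegral_count]
  simp only [← EReal.coe_neg, EReal.real_coe_toENNReal]
  rw [JumpRates.entropyRateAt]
  generalize ∑' y, ENNReal.ofReal (-(c.rate x y * Real.log (c.rate x y / c'.rate x y))) = n at *
  generalize ∑' y, ENNReal.ofReal (c.rate x y * Real.log (c.rate x y / c'.rate x y)) = p at *
  generalize ∑' y, ENNReal.ofReal (c'.rate x y * klFun (c.rate x y / c'.rate x y)) = h at *
  have hl := c.total_nonneg x
  have hl' := c'.total_nonneg x
  generalize c.total x = l at *
  generalize c'.total x = l' at *
  lift n to ℝ≥0 using hn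
  by_cases hp : p = ∞
  · have hh : h = ∞ := by
      by_contra hh
      rw [hp, top_add] at hsum
      exact ENNReal.add_ne_top.2 ⟨ENNReal.add_ne_top.2 ⟨hh, ENNReal.coe_ne_top⟩,
        ENNReal.ofReal_ne_top⟩ hsum.symm
    rw [hp, hh, EReal.coe_ennreal_top, EReal.coe_nnreal_eq_coe_real, EReal.top_sub_coe,
      EReal.top_sub_coe]
  · have hh : h ≠ ∞ := by
      rintro rfl
      rw [top_add, top_add] at hsum
      exact ENNReal.add_ne_top.2 ⟨hp, ENNReal.ofReal_ne_top⟩ hsum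
    lift p to ℝ≥0 using hp
    lift h to ℝ≥0 using hh
    have := congrArg ENNReal.toReal hsum
    rw [ENNReal.toReal_add (by simp) (by simp), ENNReal.toReal_add (by simp) (by simp),
      ENNReal.toReal_add (by simp) (by simp), ENNReal.toReal_ofReal hl, ENNReal.toReal_ofReal hl']
      at this
    simp only [ENNReal.coe_toReal] at this
    simp only [EReal.coe_nnreal_eq_coe_real, ← EReal.coe_sub]
    congr 1
    linarith

lemma relEntropyRate_eq_lintegral (c c' : JumpRates E)
    (hc : ∀ x y, c'.rate x y = 0 → c.rate x y = 0) (μ : Measure E) :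
    relEntropyRate c c' μ = ((∫⁻ x, c.entropyRateAt c' x ∂μ : ℝ≥0∞) : EReal) := by
  rw [relEntropyRate]
  simp only [eintegral_count_rate_mul_log c c' hc]
  have hneg : ∀ x, (-(c.entropyRateAt c' x : EReal)).toENNReal = 0 := fun x =>
    EReal.toENNReal_of_nonpos (EReal.neg_le_zero.2 (EReal.coe_ennreal_nonneg _))
  simp only [eintegral, EReal.toENNReal_coe, hneg, lintegral_zero]
  simp

end Rate

theorem proposition2 {E : Type*} [Countable E] [MeasurableSpace E] [DiscreteMeasurableSpace E]
    {k : ℕ} (c : EuclideanSpace ℝ (Fin k) → JumpRates E) (θ ε : EuclideanSpace ℝ (Fin k))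
    (hc : ∀ σ σ', (c θ).rate σ σ' = 0 ↔ (c (θ + ε)).rate σ σ' = 0)
    (μ ν : Measure E) [IsProbabilityMeasure μ] [IsProbabilityMeasure ν]
    (hμ : (c θ).IsStationary μ) (hν : (c (θ + ε)).IsStationary ν) (T : ℝ≥0) :
    (klDiv ((c θ).pathLaw μ T) ((c (θ + ε)).pathLaw ν T) : EReal) =
      ((T : ℝ) : EReal) * relEntropyRate (c θ) (c (θ + ε)) μ + (klDiv μ ν : EReal) := by
  have hc' : ∀ σ σ', (c (θ + ε)).rate σ σ' = 0 → (c θ).rate σ σ' = 0 := fun σ σ' => (hc σ σ').2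
  rw [JumpRates.klDiv_pathLaw, JumpRates.klDiv_truncChain _ _ μ ν T hc'
    (JumpRates.ae_exists_truncChain_snd_eq_top _ μ hμ T)
    (JumpRates.ae_exists_truncChain_snd_eq_top _ ν hν T),
    JumpRates.tsum_lintegral_meanOccupation _ μ hμ, relEntropyRate_eq_lintegral _ _ hc',
    EReal.coe_ennreal_add, EReal.coe_ennreal_mul, add_comm]
  rfl
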